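/- Throughout, $\sum_{n=1}^\infty$ denotes the limit of the partial sums (convergence, possibly conditional, being part of the claim). **(I)** Let $a,x,y$ be nonzero real numbers. If $xa\notin\mathbb Z$, then $$\frac{\pi^2}{\sin(\pi xa)\sinh(\pi ya)}=\frac1{a^2xy}+2\pi\sum_{n=1}^\infty\left\{\frac{n(-1)^n}{(n^2+a^2y^2)\sinh\left(\frac{\pi nx}{y}\right)}-\frac{n(-1)^n}{(n^2-a^2x^2)\sinh\left(\frac{\pi ny}{x}\right)}\right\},\tag{3.6}$$ $$\frac{\pi^2\cot(\pi xa)}{\sinh(\pi ya)}=\frac1{a^2xy}+2\pi\sum_{n=1}^\infty\left\{\frac{n\coth\left(\frac{\pi nx}{y}\right)}{n^2+a^2y^2}(-1)^n-\frac{n}{(n^2-a^2x^2)\sinh\left(\frac{\pi ny}{x}\right)}\right\}.\tag{3.7}$$ If $xa\neq\frac{2m-1}{2}$ for every $m\in\mathbb Z$, then $$\frac{\pi^2\tan(\pi xa)\tanh(\pi ya)}{16a^2}=\sum_{n=1}^\infty\left\{\frac{\pi x^2\tanh\left(\frac{2n-1}{2x}\pi y\right)}{(2n-1)\left[(2n-1)^2-(2xa)^2\right]}+\frac{\pi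 y^2\tanh\left(\frac{2n-1}{2y}\pi x\right)}{(2n-1)\left[(2n-1)^2+(2ya)^2\right]}\right\},\tag{3.8}$$ $$\frac{\pi^2}{16a^2\cos(\pi xa)\cosh(\pi ya)}=\frac{\pi^2}{16a^2}+\sum_{n=1}^\infty\frac{\pi y^2(-1)^n}{(2n-1)\left[(2n-1)^2+(2ya)^2\right]\cosh\left(\frac{2n-1}{2y}\pi x\right)}-\sum_{n=1}^\infty\frac{\pi x^2(-1)^n}{(2n-1)\left[(2n-1)^2-(2xa)^2\right]\cosh\left(\frac{2n-1}{2x}\pi y\right)}.\tag{3.9}$$ **(II)** Let $\alpha,\beta,w$ be positive real numbers with $\alpha\beta=\pi^2$. If $w\neq\beta n^2$ for every integer $n\ge1$, then $$\frac{\pi}{2\sin(\sqrt{w\alpha})\sinh(\sqrt{w\beta})}=\frac1{2w}+\sum_{n=1}^\infty\left\{\frac{\beta n(-1)^n}{(w-\beta n^2)\sinh(\beta n)}+\frac{\alpha n(-1)^n}{(w+\alpha n^2)\sinh(\alpha n)}\right\},\tag{3.10}$$ $$\frac{\pi\cot(\sqrt{w\alpha})}{2\sinh(\sqrt{w\beta})}=\frac1{2w}+\sum_{n=1}^\infty\left\{\frac{\beta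 n}{(w-\beta n^2)\sinh(\beta n)}+\frac{\alpha n\coth(\alpha n)}{w+\alpha n^2}(-1)^n\right\}.\tag{3.11}$$ If $4w\neq\beta(2n-1)^2$ for every integer $n\ge1$, then $$\frac{\pi\tan(\sqrt{w\alpha})\tanh(\sqrt{w\beta})}{16w}=\sum_{n=1}^\infty\left\{\frac{\tanh\left(\frac{2n-1}{2}\beta\right)}{(2n-1)\left[\beta(2n-1)^2-4w\right]}+\frac{\tanh\left(\frac{2n-1}{2}\alpha\right)}{(2n-1)\left[\alpha(2n-1)^2+4w\right]}\right\},\tag{3.12}$$ $$\frac{\pi}{16w\cos(\sqrt{w\alpha})\cosh(\sqrt{w\beta})}=\frac{\pi}{16w}+\sum_{n=1}^\infty\frac{(-1)^n}{(2n-1)\left[4w-\beta(2n-1)^2\right]\cosh\left(\frac{2n-1}{2}\beta\right)}+\sum_{n=1}^\infty\frac{(-1)^n}{(2n-1)\left[4w+\alpha(2n-1)^2\right]\cosh\left(\frac{2n-1}{2}\alpha\right)}.\tag{3.13}$$ -/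

import Mathlib

open Filter Topology

/-- The hyperbolic cotangent of a real number (it has its only pole at `0`). -/
noncomputable def coth (t : ℝ) : ℝ := Real.cosh t / Real.sinh t

/-- `SeriesEq f s` says that the series `f 1 + f 2 + f 3 + ⋯` converges, with sum `s`: its partial
sums, in the usual order, tend to `s`. (Convergence may be conditional.) -/
def SeriesEq (f : ℕ → ℝ) (s : ℝ) : Prop :=
  Tendsto (fun N : ℕ => ∑ n ∈ Finset.Icc 1 N, f n) atTop (𝓝 s)

/-! Each left-hand side is, up to elementary terms, a product F·G of two partial fraction series, F
= ∑ c_m/(P_m − AX) (trigonometric) and G = ∑ d_n/(Q_n + AY) (hyperbolic), with X = x², Y = y², A a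
multiple of a², and P, Q squares of integers. Since X(Q + AY) + Y(P − AX) = XQ + YP, the product
1/((P − AX)(Q + AY)) splits as [X/(P − AX) + Y/(Q + AY)]/(XQ + YP). Both resulting double series
converge absolutely, so each may be summed first over the index absent from its pole factor. That
inner sum is again a partial fraction expansion, of a hyperbolic function at a multiple of y/x or
x/y. This is `exists_hasSum_mul_eq_add`.

For tan·tanh this is already the formula. For sec·sech, absolute convergence requires the expansions
of sec − 1 and 1 − sech; after rewriting AX/(P(P − AX)) = 1/(P − AX) − 1/P, the leftover terms are
the two iterated sums of one symmetric double series free of a, and they cancel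
(`exists_hasSum_odd_char_symm`).

For csc·csch and cot·csch the same rewriting leaves a constant K independent of a
(`exists_csch_product_eq_add_const`). Letting xa run through j + 1/2 makes every other term tend to
0, so K = 0. In the cot case the series converges only conditionally because coth tends to ±1: the
limiting sign is split off and the remaining alternating series is replaced by an absolutely
convergent series of increments.

The formulas in α, β, w are those in a, x, y with x = √α, y = √β, a = √w/π, for which xy = π. -/

/-! ### Absolute convergence of series with shifted denominators. -/

/-- Once ‖P n‖ exceeds 2‖w‖, the shift by w at most halves the denominator. A possible zero of P n −
w costs only finitely many terms. -/
theorem summable_norm_div_sub {𝕜 : Type*} [NormedField 𝕜] {c P : ℕ → 𝕜}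
    (hP : Tendsto (fun n => ‖P n‖) atTop atTop) (hc : Summable fun n => ‖c n / P n‖) (w : 𝕜) :
    Summable fun n => ‖c n / (P n - w)‖ := by
  refine Summable.of_norm_bounded_eventually_nat (g := fun n => 2 * ‖c n / P n‖) (hc.mul_left 2) ?_
  filter_upwards [hP.eventually_ge_atTop (2 * ‖w‖ + 1)] with n hn
  have h1 : ‖P n‖ - ‖w‖ ≤ ‖P n - w‖ := norm_sub_norm_le _ _
  have h0 := norm_nonneg w
  rw [norm_norm, norm_div, norm_div, ← mul_div_assoc, div_le_div_iff₀ (by linarith) (by linarith)]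
  nlinarith [norm_nonneg (c n)]

theorem tendsto_norm_sq_atTop {𝕜 : Type*} [RCLike 𝕜] (a b : ℕ) (ha : a ≠ 0) :
    Tendsto (fun n : ℕ => ‖((a : 𝕜) * n + b) ^ 2‖) atTop atTop := by
  have h : ∀ n : ℕ, ‖((a : 𝕜) * n + b) ^ 2‖ = (((a * n + b) ^ 2 : ℕ) : ℝ) := fun n => by
    rw [norm_pow, show (a : 𝕜) * n + b = ((a * n + b : ℕ) : 𝕜) by push_cast; ring,
      RCLike.norm_natCast]
    push_cast; ring
  simp_rw [h]
  refine tendsto_natCast_atTop_atTop.comp (tendsto_atTop_mono (fun n => ?_) tendsto_id)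
  have : 1 ≤ a := Nat.one_le_iff_ne_zero.mpr ha
  simp only [id]
  nlinarith [Nat.zero_le (a * n + b), Nat.zero_le b, Nat.zero_le ((a * n + b) * (a * n + b - 1)),
    Nat.le_self_pow (two_ne_zero) (a * n + b), Nat.le_mul_of_pos_left n this]

theorem summable_norm_div_sq {𝕜 : Type*} [RCLike 𝕜] {c : ℕ → 𝕜} (hc : ∀ n, ‖c n‖ ≤ 1) (a b : ℕ)
    (ha : a ≠ 0) (hb : b ≠ 0) : Summable fun n : ℕ => ‖c n / ((a : 𝕜) * n + b) ^ 2‖ := by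
  have h : Summable fun n : ℕ => 1 / ((n + 1 : ℕ) : ℝ) ^ 2 :=
    (summable_nat_add_iff (f := fun n : ℕ => 1 / (n : ℝ) ^ 2) 1).2
      (Real.summable_one_div_nat_pow.2 one_lt_two)
  refine h.of_nonneg_of_le (fun _ => norm_nonneg _) fun n => ?_
  rw [norm_div, norm_pow, show (a : 𝕜) * n + b = ((a * n + b : ℕ) : 𝕜) by push_cast; ring,
    RCLike.norm_natCast]
  have : n + 1 ≤ a * n + b := by
    have : 1 ≤ a := Nat.one_le_iff_ne_zero.mpr ha
    have := Nat.le_mul_of_pos_left n this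
    omega
  gcongr
  exact hc n

theorem HasSum.congr_left_right {𝕜 ι : Type*} [NormedField 𝕜] {f g : ι → 𝕜} {a b : 𝕜}
    (h : HasSum g b) (hf : ∀ n, f n = g n) (ha : a = b) : HasSum f a := by
  rw [ha, funext hf]
  exact h

theorem tendsto_one_div_natCast_add (w : ℂ) :
    Tendsto (fun N : ℕ => 1 / ((N : ℂ) + w)) atTop (𝓝 0) := by
  simp only [one_div]
  refine tendsto_inv₀_cobounded.comp ((tendsto_add_const_cobounded w).comp ?_)
  rw [← tendsto_norm_atTop_iff_cobounded]
  simpa using tendsto_natCast_atTop_atTop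

/-! ### Partial fractions of cot, csc, tan and sec over ℂ. -/

namespace Complex

theorem hasSum_cot_pi {z : ℂ} (hz : z ∈ integerComplement) :
    HasSum (fun m : ℕ => 1 / (((m : ℂ) + 1) ^ 2 - z ^ 2))
      ((1 / z - Real.pi * cot (Real.pi * z)) / (2 * z)) := by
  have h0 : z ≠ 0 := integerComplement.ne_zero hz
  have h := (summable_cotTerm hz).hasSum
  rw [show ∑' n, cotTerm z n = Real.pi * cot (Real.pi * z) - 1 / z from
    (cot_series_rep' hz).symm] at h
  refine (h.mul_left (-1 / (2 * z))).congr_left_right (fun m => ?_) ?_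
  · rw [cotTerm_identity hz,
      show (z + (m + 1)) * (z - (m + 1)) = -(((m : ℂ) + 1) ^ 2 - z ^ 2) by ring]
    field_simp
  · field_simp
    ring

theorem half_mem_integerComplement {z : ℂ} (hz : z ∈ integerComplement) :
    z / 2 ∈ integerComplement := by
  rintro ⟨m, hm⟩
  refine hz ⟨2 * m, ?_⟩
  push_cast
  rw [hm]; ring

/-- From csc s = cot(s/2) − cot s: the alternating series is the sum over even integers minus the
sum over odd ones, and the even part is a quarter of the cotangent series at z/2. -/
theorem hasSum_csc_pi {z : ℂ} (hz : z ∈ integerComplement) :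
    HasSum (fun m : ℕ => (-1) ^ (m + 1) / (((m : ℂ) + 1) ^ 2 - z ^ 2))
      ((1 / z - Real.pi / sin (Real.pi * z)) / (2 * z)) := by
  have h0 : z ≠ 0 := integerComplement.ne_zero hz
  have hall := hasSum_cot_pi hz
  have hhalf := (hasSum_cot_pi (half_mem_integerComplement hz)).mul_left (1 / 4)
  have hev : Summable fun i : ℕ => 1 / ((((2 * i : ℕ) : ℂ) + 1) ^ 2 - z ^ 2) :=
    hall.summable.comp_injective (i := fun i : ℕ => 2 * i) fun a b h => by simpa using h
  obtain ⟨A, hA⟩ := hev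
  set B := (1 / 4) * ((1 / (z / 2) - Real.pi * cot (Real.pi * (z / 2))) / (2 * (z / 2))) with hB
  -- Odd indices carry the even integers 2i + 2, because the index m stands for the integer m + 1.
  have hodd : HasSum (fun i : ℕ => 1 / ((((2 * i + 1 : ℕ) : ℂ) + 1) ^ 2 - z ^ 2)) B := by
    refine hhalf.congr_left_right (fun i => ?_) rfl
    rw [div_mul_div_comm]
    congr 1
    · norm_num
    · push_cast; ring
  have hsum := hall.unique (HasSum.even_add_odd hA hodd)
  have key : HasSum (fun m : ℕ => (-1) ^ (m + 1) / (((m : ℂ) + 1) ^ 2 - z ^ 2)) (-A + B) := by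
    refine HasSum.even_add_odd ?_ ?_
    · refine hA.neg.congr_left_right (fun i => ?_) rfl
      rw [pow_succ, pow_mul]; norm_num
      ring
    · refine hodd.congr_left_right (fun i => ?_) rfl
      rw [show 2 * i + 1 + 1 = 2 * (i + 1) by ring, pow_mul]; norm_num
  refine key.congr_left_right (fun _ => rfl) ?_
  have hA' : A = (1 / z - Real.pi * cot (Real.pi * z)) / (2 * z) - B := by rw [hsum]; ring
  rw [hA', hB]
  have hs : sin (Real.pi * (z / 2)) ≠ 0 := sin_pi_mul_ne_zero (half_mem_integerComplement hz)
  have hs2 : sin (Real.pi * z) ≠ 0 := sin_pi_mul_ne_zero hz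
  have e : (Real.pi : ℂ) * z = 2 * (Real.pi * (z / 2)) := by ring
  have key : cot (Real.pi * (z / 2)) - cot (Real.pi * z) = 1 / sin (Real.pi * z) := by
    rw [cot, cot, div_sub_div _ _ hs hs2, div_eq_div_iff (mul_ne_zero hs hs2) hs2, e, sin_two_mul,
      cos_two_mul]
    ring
  rw [div_eq_mul_one_div (Real.pi : ℂ) (sin _), ← key]
  field_simp
  ring

theorem odd_add_ne_zero {z : ℂ} (hz : z + 1 / 2 ∈ integerComplement) (m : ℕ) :
    (2 * m + 1 : ℂ) - 2 * z ≠ 0 ∧ (2 * m + 1 : ℂ) + 2 * z ≠ 0 := by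
  constructor
  · intro h
    exact hz ⟨m + 1, by push_cast; linear_combination h / 2⟩
  · intro h
    exact hz ⟨-m, by push_cast; linear_combination - h / 2⟩

/-- Uses tan πz = −cot π(z + 1/2). The cotangent series pairs the poles about z + 1/2 = 0, the
tangent series about z = 0; the partial sums differ by re-pairing, which leaves one boundary term
1/(N + 1/2 + z) tending to 0. -/
theorem hasSum_tan_pi {z : ℂ} (h0 : z ≠ 0) (hz : z + 1 / 2 ∈ integerComplement) :
    HasSum (fun m : ℕ => 1 / ((2 * (m : ℂ) + 1) ^ 2 - 4 * z ^ 2))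
      (Real.pi * tan (Real.pi * z) / (8 * z)) := by
  have hs : Summable (fun m : ℕ => 1 / ((2 * (m : ℂ) + 1) ^ 2 - 4 * z ^ 2)) := by
    have := summable_norm_div_sub (tendsto_norm_sq_atTop (𝕜 := ℂ) 2 1 two_ne_zero)
      (summable_norm_div_sq (c := fun _ => (1 : ℂ)) (by simp) 2 1 two_ne_zero one_ne_zero)
      (4 * z ^ 2)
    simpa using this.of_norm
  rw [hs.hasSum_iff_tendsto_nat]
  have hc := tendsto_logDeriv_euler_cot_sub hz
  have hlim := tendsto_one_div_natCast_add (1 / 2 + z)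
  have e : ∀ N : ℕ, ∑ m ∈ Finset.range N, 1 / ((2 * (m : ℂ) + 1) ^ 2 - 4 * z ^ 2)
      = - (1 / (8 * z)) * (∑ j ∈ Finset.range N, cotTerm (z + 1 / 2) j + 1 / (z + 1 / 2)
        - 1 / ((N : ℂ) + (1 / 2 + z))) := by
    intro N
    induction N with
    | zero => simp; right; ring
    | succ N ih =>
      rw [Finset.sum_range_succ, Finset.sum_range_succ, ih, cotTerm]
      obtain ⟨h1, h2⟩ := odd_add_ne_zero hz N
      obtain ⟨-, h3⟩ := odd_add_ne_zero hz (N + 1)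
      push_cast at h3 ⊢
      rw [show (2 * (N : ℂ) + 1) ^ 2 - 4 * z ^ 2 = (2 * N + 1 - 2 * z) * (2 * N + 1 + 2 * z) by ring,
        show z + 1 / 2 - ((N : ℂ) + 1) = -(2 * N + 1 - 2 * z) / 2 by ring,
        show z + 1 / 2 + ((N : ℂ) + 1) = (2 * (N + 1) + 1 + 2 * z) / 2 by ring,
        show (N : ℂ) + 1 + (1 / 2 + z) = (2 * (N + 1) + 1 + 2 * z) / 2 by ring,
        show (N : ℂ) + (1 / 2 + z) = (2 * N + 1 + 2 * z) / 2 by ring]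
      have key : 1 / ((2 * (N : ℂ) + 1 - 2 * z) * (2 * N + 1 + 2 * z)) = -(1 / (8 * z)) *
          (1 / (-(2 * N + 1 - 2 * z) / 2) + 1 / ((2 * N + 1 + 2 * z) / 2)) := by
        generalize hB : 2 * (N : ℂ) + 1 + 2 * z = B at *
        have hA : 2 * (N : ℂ) + 1 - 2 * z = B - 4 * z := by rw [← hB]; ring
        rw [hA] at h1 ⊢
        field_simp
        ring
      rw [key]
      ring
  simp_rw [e]
  have := ((hc.add_const (1 / (z + 1 / 2))).sub hlim).const_mul (-(1 / (8 * z)))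
  convert this using 2
  rw [show (Real.pi : ℂ) * (z + 1 / 2) = Real.pi * z + Real.pi / 2 by ring, cot,
    cos_add_pi_div_two, sin_add_pi_div_two, tan]
  ring

/-- The cosecant expansion at z + 1/2, re-paired as for the tangent. The terms decay only like 1/m,
so the conclusion is a limit of partial sums rather than a `HasSum`. -/
theorem tendsto_sec_pi {z : ℂ} (hz : z + 1 / 2 ∈ integerComplement) :
    Tendsto (fun N : ℕ => ∑ m ∈ Finset.range N,
      (-1) ^ m * (2 * (m : ℂ) + 1) / ((2 * (m : ℂ) + 1) ^ 2 - 4 * z ^ 2))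
      atTop (𝓝 (Real.pi / (4 * cos (Real.pi * z)))) := by
  have hw : z + 1 / 2 ≠ 0 := integerComplement.ne_zero hz
  have hc := (hasSum_csc_pi hz).tendsto_sum_nat
  have hlim : Tendsto (fun N : ℕ => (-1) ^ N * (1 / ((N : ℂ) + (1 / 2 + z)))) atTop (𝓝 0) := by
    rw [tendsto_zero_iff_norm_tendsto_zero]
    simpa using (tendsto_one_div_natCast_add (1 / 2 + z)).norm
  have e : ∀ N : ℕ, ∑ m ∈ Finset.range N,
      (-1) ^ m * (2 * (m : ℂ) + 1) / ((2 * (m : ℂ) + 1) ^ 2 - 4 * z ^ 2)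
      = 1 / 4 * (1 / (z + 1 / 2) - 2 * (z + 1 / 2) * ∑ j ∈ Finset.range N,
          (-1) ^ (j + 1) / (((j : ℂ) + 1) ^ 2 - (z + 1 / 2) ^ 2)
        - (-1) ^ N * (1 / ((N : ℂ) + (1 / 2 + z)))) := by
    intro N
    induction N with
    | zero => simp [add_comm]
    | succ N ih =>
      rw [Finset.sum_range_succ, Finset.sum_range_succ, ih]
      obtain ⟨h1, h2⟩ := odd_add_ne_zero hz N
      obtain ⟨-, h3⟩ := odd_add_ne_zero hz (N + 1)
      push_cast at h3 ⊢
      rw [show (2 * (N : ℂ) + 1) ^ 2 - 4 * z ^ 2 = (2 * N + 1 - 2 * z) * (2 * N + 1 + 2 * z) by ring,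
        show ((N : ℂ) + 1) ^ 2 - (z + 1 / 2) ^ 2
          = (2 * N + 1 - 2 * z) * (2 * (N + 1) + 1 + 2 * z) / 4 by ring,
        show (N : ℂ) + 1 + (1 / 2 + z) = (2 * (N + 1) + 1 + 2 * z) / 2 by ring,
        show (N : ℂ) + (1 / 2 + z) = (2 * N + 1 + 2 * z) / 2 by ring, pow_succ]
      have key : (2 * (N : ℂ) + 1) / ((2 * N + 1 - 2 * z) * (2 * N + 1 + 2 * z)) =
          1 / 4 * (2 * (z + 1 / 2) *
            (1 / ((2 * N + 1 - 2 * z) * (2 * (N + 1) + 1 + 2 * z) / 4))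
            + 1 / ((2 * (N + 1) + 1 + 2 * z) / 2) + 1 / ((2 * N + 1 + 2 * z) / 2)) := by
        have hz2 : 2 * (z + 1 / 2) = (2 * N + 1 + 2 * z - (2 * N + 1 - 2 * z) + 2) / 2 := by ring
        have hN : 2 * (N : ℂ) + 1 = (2 * N + 1 + 2 * z + (2 * N + 1 - 2 * z)) / 2 := by ring
        have hC : 2 * ((N : ℂ) + 1) + 1 + 2 * z = 2 * N + 1 + 2 * z + 2 := by ring
        rw [hC] at h3 ⊢
        rw [hz2]
        nth_rewrite 1 [hN]
        generalize 2 * (N : ℂ) + 1 + 2 * z = B at *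
        generalize 2 * (N : ℂ) + 1 - 2 * z = A at *
        field_simp
        ring
      rw [mul_div_assoc, key]
      ring
  simp_rw [e]
  have := (((hc.const_mul (2 * (z + 1 / 2))).const_sub (1 / (z + 1 / 2))).sub hlim).const_mul
    (1 / 4 : ℂ)
  convert this using 2
  have hs : sin (Real.pi * (z + 1 / 2)) = cos (Real.pi * z) := by
    rw [show (Real.pi : ℂ) * (z + 1 / 2) = Real.pi * z + Real.pi / 2 by ring,
      sin_add_pi_div_two]
  have hs0 := sin_pi_mul_ne_zero hz
  rw [hs] at hs0 ⊢
  generalize z + 1 / 2 = w at hw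
  field_simp
  ring

theorem one_half_mem_integerComplement : (0 : ℂ) + 1 / 2 ∈ integerComplement := by
  rintro ⟨m, hm⟩
  have : ((2 * m : ℤ) : ℂ) = (1 : ℤ) := by push_cast; rw [hm]; norm_num
  have := Int.cast_injective this
  omega

/-- Subtracting the secant expansion at 0 from that at z gains absolute convergence: with p = 2m +
1, p/(p² − 4z²) − 1/p = 4z²/(p(p² − 4z²)). -/
theorem hasSum_sec_pi {z : ℂ} (h0 : z ≠ 0) (hz : z + 1 / 2 ∈ integerComplement) :
    HasSum (fun m : ℕ => (-1) ^ m / ((2 * (m : ℂ) + 1) * ((2 * (m : ℂ) + 1) ^ 2 - 4 * z ^ 2)))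
      (Real.pi / (16 * z ^ 2) * (1 / cos (Real.pi * z) - 1)) := by
  have hne : ∀ m : ℕ, (2 * (m : ℂ) + 1) ≠ 0 := fun m => by exact_mod_cast Nat.succ_ne_zero (2 * m)
  have hs : Summable fun m : ℕ =>
      (-1) ^ m / ((2 * (m : ℂ) + 1) * ((2 * (m : ℂ) + 1) ^ 2 - 4 * z ^ 2)) := by
    have h1 : ∀ m : ℕ, ‖(-1) ^ m / (2 * (m : ℂ) + 1)‖ ≤ 1 := fun m => by
      rw [show 2 * (m : ℂ) + 1 = ((2 * m + 1 : ℕ) : ℂ) by push_cast; ring]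
      rw [norm_div, norm_pow, norm_neg, norm_one, one_pow, Complex.norm_natCast]
      exact div_le_one_of_le₀ (by simp) (by positivity)
    have := summable_norm_div_sub (tendsto_norm_sq_atTop (𝕜 := ℂ) 2 1 two_ne_zero)
      (summable_norm_div_sq h1 2 1 two_ne_zero one_ne_zero) (4 * z ^ 2)
    simpa [div_div] using this.of_norm
  rw [hs.hasSum_iff_tendsto_nat]
  have := ((tendsto_sec_pi hz).sub (tendsto_sec_pi one_half_mem_integerComplement)).const_mul
    (1 / (4 * z ^ 2))
  convert this using 2 with N
  · rw [← Finset.sum_sub_distrib, Finset.mul_sum]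
    refine Finset.sum_congr rfl fun m _ => ?_
    obtain ⟨h1, h2⟩ := odd_add_ne_zero hz m
    have h3 : (2 * (m : ℂ) + 1) ^ 2 - 4 * z ^ 2 ≠ 0 := by
      rw [show (2 * (m : ℂ) + 1) ^ 2 - 4 * z ^ 2 = (2 * m + 1 - 2 * z) * (2 * m + 1 + 2 * z) by ring]
      exact mul_ne_zero h1 h2
    have h4 := hne m
    rw [zero_pow two_ne_zero, mul_zero, sub_zero]
    field_simp
    ring
  · rw [mul_zero, cos_zero]
    ring

end Complex

/-! ### Real expansions, the hyperbolic ones obtained from z = iv. -/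

open Complex in
theorem Complex.ofReal_add_mem_integerComplement {u : ℝ} (b : ℝ) (hu : ∀ m : ℤ, u + b ≠ m) :
    (u : ℂ) + b ∈ integerComplement := by
  rintro ⟨m, hm⟩
  exact hu m (by exact_mod_cast hm.symm)

open Complex in
theorem Complex.mul_I_add_mem_integerComplement {v : ℝ} (b : ℝ) (hv : v ≠ 0) :
    (v : ℂ) * I + b ∈ integerComplement := by
  rintro ⟨m, hm⟩
  have := congrArg Complex.im hm
  simp at this
  exact hv this.symm

namespace Real

theorem hasSum_cot_pi {u : ℝ} (hu : ∀ m : ℤ, u ≠ m) :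
    HasSum (fun m : ℕ => 1 / (((m : ℝ) + 1) ^ 2 - u ^ 2)) ((1 / u - π * cot (π * u)) / (2 * u)) := by
  have hz : (u : ℂ) ∈ Complex.integerComplement := by
    simpa using Complex.ofReal_add_mem_integerComplement (u := u) 0 (by simpa using hu)
  rw [← Complex.hasSum_ofReal]
  refine (Complex.hasSum_cot_pi hz).congr_left_right (fun m => ?_) ?_ <;> push_cast <;> rfl

theorem hasSum_csc_pi {u : ℝ} (hu : ∀ m : ℤ, u ≠ m) :
    HasSum (fun m : ℕ => (-1) ^ (m + 1) / (((m : ℝ) + 1) ^ 2 - u ^ 2))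
      ((1 / u - π / sin (π * u)) / (2 * u)) := by
  have hz : (u : ℂ) ∈ Complex.integerComplement := by
    simpa using Complex.ofReal_add_mem_integerComplement (u := u) 0 (by simpa using hu)
  rw [← Complex.hasSum_ofReal]
  refine (Complex.hasSum_csc_pi hz).congr_left_right (fun m => ?_) ?_ <;> push_cast <;> rfl

theorem hasSum_tan_pi {u : ℝ} (h0 : u ≠ 0) (hu : ∀ m : ℤ, u + 1 / 2 ≠ m) :
    HasSum (fun m : ℕ => 1 / ((2 * (m : ℝ) + 1) ^ 2 - 4 * u ^ 2)) (π * tan (π * u) / (8 * u)) := by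
  have hz : (u : ℂ) + 1 / 2 ∈ Complex.integerComplement := by
    simpa using Complex.ofReal_add_mem_integerComplement (u := u) (1 / 2) hu
  rw [← Complex.hasSum_ofReal]
  refine (Complex.hasSum_tan_pi (by exact_mod_cast h0) hz).congr_left_right (fun m => ?_) ?_ <;>
    push_cast <;> rfl

theorem hasSum_sec_pi {u : ℝ} (h0 : u ≠ 0) (hu : ∀ m : ℤ, u + 1 / 2 ≠ m) :
    HasSum (fun m : ℕ => (-1) ^ m / ((2 * (m : ℝ) + 1) * ((2 * (m : ℝ) + 1) ^ 2 - 4 * u ^ 2)))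
      (π / (16 * u ^ 2) * (1 / cos (π * u) - 1)) := by
  have hz : (u : ℂ) + 1 / 2 ∈ Complex.integerComplement := by
    simpa using Complex.ofReal_add_mem_integerComplement (u := u) (1 / 2) hu
  rw [← Complex.hasSum_ofReal]
  refine (Complex.hasSum_sec_pi (by exact_mod_cast h0) hz).congr_left_right (fun m => ?_) ?_ <;>
    push_cast <;> rfl

theorem hasSum_coth_pi {v : ℝ} (hv : v ≠ 0) :
    HasSum (fun m : ℕ => 1 / (((m : ℝ) + 1) ^ 2 + v ^ 2))
      ((π * (cosh (π * v) / sinh (π * v)) - 1 / v) / (2 * v)) := by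
  have hz : (v : ℂ) * Complex.I ∈ Complex.integerComplement := by
    simpa using Complex.mul_I_add_mem_integerComplement 0 hv
  rw [← Complex.hasSum_ofReal]
  refine (Complex.hasSum_cot_pi hz).congr_left_right (fun m => ?_) ?_
  · push_cast
    rw [mul_pow, Complex.I_sq, mul_neg_one, sub_neg_eq_add]
  · have hs : Complex.sinh (π * v) ≠ 0 := by
      rw [← Complex.ofReal_mul, ← Complex.ofReal_sinh]
      exact_mod_cast sinh_eq_zero.not.2 (mul_ne_zero pi_ne_zero hv)
    have hv' : (v : ℂ) ≠ 0 := by exact_mod_cast hv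
    have hI := Complex.I_ne_zero
    rw [Complex.cot, ← mul_assoc, Complex.cos_mul_I, Complex.sin_mul_I]
    push_cast
    field_simp
    rw [Complex.I_sq]
    ring

theorem hasSum_csch_pi {v : ℝ} (hv : v ≠ 0) :
    HasSum (fun m : ℕ => (-1) ^ (m + 1) / (((m : ℝ) + 1) ^ 2 + v ^ 2))
      ((π * (1 / sinh (π * v)) - 1 / v) / (2 * v)) := by
  have hz : (v : ℂ) * Complex.I ∈ Complex.integerComplement := by
    simpa using Complex.mul_I_add_mem_integerComplement 0 hv
  rw [← Complex.hasSum_ofReal]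
  refine (Complex.hasSum_csc_pi hz).congr_left_right (fun m => ?_) ?_
  · push_cast
    rw [mul_pow, Complex.I_sq, mul_neg_one, sub_neg_eq_add]
  · have hs : Complex.sinh (π * v) ≠ 0 := by
      rw [← Complex.ofReal_mul, ← Complex.ofReal_sinh]
      exact_mod_cast sinh_eq_zero.not.2 (mul_ne_zero pi_ne_zero hv)
    have hv' : (v : ℂ) ≠ 0 := by exact_mod_cast hv
    have hI := Complex.I_ne_zero
    rw [← mul_assoc, Complex.sin_mul_I]
    push_cast
    field_simp
    rw [Complex.I_sq]
    ring

theorem hasSum_tanh_pi {v : ℝ} (hv : v ≠ 0) :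
    HasSum (fun m : ℕ => 1 / ((2 * (m : ℝ) + 1) ^ 2 + 4 * v ^ 2))
      (π * tanh (π * v) / (8 * v)) := by
  have hz : (v : ℂ) * Complex.I + 1 / 2 ∈ Complex.integerComplement := by
    simpa using Complex.mul_I_add_mem_integerComplement (1 / 2) hv
  have hv' : (v : ℂ) ≠ 0 := by exact_mod_cast hv
  have hI := Complex.I_ne_zero
  rw [← Complex.hasSum_ofReal]
  refine (Complex.hasSum_tan_pi (mul_ne_zero hv' hI) hz).congr_left_right (fun m => ?_) ?_
  · push_cast
    rw [mul_pow, Complex.I_sq, mul_neg_one, mul_neg, sub_neg_eq_add]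
  · rw [← mul_assoc, Complex.tan_mul_I]
    push_cast
    field_simp

theorem hasSum_sech_pi {v : ℝ} (hv : v ≠ 0) :
    HasSum (fun m : ℕ => (-1) ^ m / ((2 * (m : ℝ) + 1) * ((2 * (m : ℝ) + 1) ^ 2 + 4 * v ^ 2)))
      (π / (16 * v ^ 2) * (1 - 1 / cosh (π * v))) := by
  have hz : (v : ℂ) * Complex.I + 1 / 2 ∈ Complex.integerComplement := by
    simpa using Complex.mul_I_add_mem_integerComplement (1 / 2) hv
  have hv' : (v : ℂ) ≠ 0 := by exact_mod_cast hv
  have hI := Complex.I_ne_zero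
  rw [← Complex.hasSum_ofReal]
  refine (Complex.hasSum_sec_pi (mul_ne_zero hv' hI) hz).congr_left_right (fun m => ?_) ?_
  · push_cast
    rw [mul_pow, Complex.I_sq, mul_neg_one, mul_neg, sub_neg_eq_add]
  · rw [← mul_assoc, Complex.cos_mul_I, mul_pow, Complex.I_sq]
    push_cast
    ring

end Real

/-! ### Absolutely convergent double series and products of partial fractions. -/

theorem summable_of_norm_le_mul {ι κ : Type*} {f : ι × κ → ℝ} {a : ι → ℝ} {b : κ → ℝ}
    (ha : Summable fun i => ‖a i‖) (hb : Summable fun j => ‖b j‖)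
    (h : ∀ i j, ‖f (i, j)‖ ≤ ‖a i‖ * ‖b j‖) : Summable f :=
  Summable.of_norm_bounded (ha.mul_of_nonneg hb (fun _ => norm_nonneg _) fun _ => norm_nonneg _)
    fun x => h x.1 x.2

theorem exists_hasSum_fiberwise {ι κ : Type*} {f : ι × κ → ℝ} (hf : Summable f) {D : ι → ℝ}
    {C : κ → ℝ} (hD : ∀ i, HasSum (fun j => f (i, j)) (D i))
    (hC : ∀ j, HasSum (fun i => f (i, j)) (C j)) :
    ∃ S, HasSum f S ∧ HasSum D S ∧ HasSum C S := by
  obtain ⟨S, hS⟩ := hf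
  exact ⟨S, hS, hS.prod_fiberwise hD,
    (((Equiv.prodComm κ ι).hasSum_iff).2 hS).prod_fiberwise hC⟩

section PartialFractionProduct

variable {c d P Q C D : ℕ → ℝ} {A X Y F G : ℝ}

/-- Since X/(XQ + YP) ≤ 1/Q by positivity, the double series is dominated by a product of two
convergent series and may be summed over n first. -/
theorem exists_hasSum_partialFraction_left (hX : 0 < X) (hY : 0 < Y) (hP : ∀ m, 0 < P m)
    (hQ : ∀ n, 0 < Q n)
    (hc : Summable fun m => ‖c m / (P m - A)‖) (hd : Summable fun n => ‖d n / Q n‖)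
    (hD : ∀ m, HasSum (fun n => d n / (X * Q n + Y * P m)) (D m)) :
    ∃ S, HasSum (fun p : ℕ × ℕ =>
        c p.1 / (P p.1 - A) * (X * (d p.2 / (X * Q p.2 + Y * P p.1)))) S ∧
      HasSum (fun m => c m / (P m - A) * (X * D m)) S := by
  have hs : Summable fun p : ℕ × ℕ =>
        c p.1 / (P p.1 - A) * (X * (d p.2 / (X * Q p.2 + Y * P p.1))) := by
    refine summable_of_norm_le_mul hc hd fun m n => ?_
    have h1 := mul_pos hX (hQ n)
    have h2 := mul_pos hY (hP m)
    rw [norm_mul]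
    refine mul_le_mul_of_nonneg_left ?_ (norm_nonneg _)
    rw [norm_mul, norm_div, norm_div, Real.norm_of_nonneg hX.le, Real.norm_of_nonneg (hQ n).le,
      Real.norm_of_nonneg (add_pos h1 h2).le, ← mul_div_assoc,
      div_le_div_iff₀ (add_pos h1 h2) (hQ n)]
    nlinarith [norm_nonneg (d n), mul_nonneg (norm_nonneg (d n)) h2.le]
  obtain ⟨S, hS⟩ := hs
  exact ⟨S, hS, hS.prod_fiberwise fun m => ((hD m).mul_left X).mul_left _⟩

/-- The product of the series `∑ c m / (P m - A X)` and `∑ d n / (Q n + A Y)`, rearranged by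
splitting `1 / ((P m - A X) (Q n + A Y))` over the common value `X Q n + Y P m`. -/
theorem exists_hasSum_mul_eq_add (hX : 0 < X) (hY : 0 < Y) (hP : ∀ m, 0 < P m)
    (hQ : ∀ n, 0 < Q n) (hPA : ∀ m, P m - A * X ≠ 0) (hQA : ∀ n, Q n + A * Y ≠ 0)
    (hc : Summable fun m => ‖c m / P m‖) (hd : Summable fun n => ‖d n / Q n‖)
    (hc' : Summable fun m => ‖c m / (P m - A * X)‖) (hd' : Summable fun n => ‖d n / (Q n + A * Y)‖)
    (hF : HasSum (fun m => c m / (P m - A * X)) F) (hG : HasSum (fun n => d n / (Q n + A * Y)) G)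
    (hD : ∀ m, HasSum (fun n => d n / (X * Q n + Y * P m)) (D m))
    (hC : ∀ n, HasSum (fun m => c m / (X * Q n + Y * P m)) (C n)) :
    ∃ S T, HasSum (fun m => c m / (P m - A * X) * (X * D m)) S ∧
      HasSum (fun n => d n / (Q n + A * Y) * (Y * C n)) T ∧ F * G = S + T := by
  obtain ⟨S, hS, hS'⟩ := exists_hasSum_partialFraction_left hX hY hP hQ hc' hd hD
  -- The other half is the same statement with the two families exchanged and the sign of the shift
  -- reversed.
  obtain ⟨T, hT, hT'⟩ := exists_hasSum_partialFraction_left (A := -(A * Y)) hY hX hQ hP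
    (by simpa using hd') hc fun n => by simpa [add_comm] using hC n
  refine ⟨S, T, hS', by simpa using hT', ?_⟩
  have hFG := hF.mul hG (summable_mul_of_summable_norm hc' hd')
  have hT2 := ((Equiv.prodComm ℕ ℕ).hasSum_iff).2 hT
  refine hFG.unique ((hS.add hT2).congr_left_right (fun p => ?_) rfl)
  have h1 := hPA p.1
  have h2 := hQA p.2
  have h3 : X * Q p.2 + Y * P p.1 ≠ 0 :=
    (add_pos (mul_pos hX (hQ _)) (mul_pos hY (hP _))).ne'
  simp only [Function.comp, Equiv.prodComm_apply, Prod.fst_swap, Prod.snd_swap, sub_neg_eq_add]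
  rw [add_comm (Y * P p.1)]
  generalize hp : P p.1 = p' at *
  generalize hq : Q p.2 = q' at *
  rw [show c p.1 / (p' - A * X) * (X * (d p.2 / (X * q' + Y * p'))) +
      d p.2 / (q' + A * Y) * (Y * (c p.1 / (X * q' + Y * p')))
      = c p.1 * d p.2 * ((X / (p' - A * X) + Y / (q' + A * Y)) / (X * q' + Y * p')) by ring,
    div_add_div _ _ h1 h2,
    show X * (q' + A * Y) + (p' - A * X) * Y = X * q' + Y * p' by ring, div_div,
    mul_comm ((p' - A * X) * (q' + A * Y)), div_mul_cancel_left₀ h3, div_mul_div_comm]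
  rfl

end PartialFractionProduct

/-! ### Series indexed from 1 and sums over odd integers. -/

theorem HasSum.seriesEq {f : ℕ → ℝ} {s : ℝ} (h : HasSum (fun n => f (n + 1)) s) :
    SeriesEq f s := by
  refine h.tendsto_sum_nat.congr fun N => ?_
  rw [Finset.range_eq_Ico, Finset.sum_Ico_add' f 0 N 1]
  rfl

theorem HasSum.seriesEq_of_eq {f g : ℕ → ℝ} {s t : ℝ} (h : HasSum g s)
    (hf : ∀ n, f (n + 1) = g n) (hs : t = s) : SeriesEq f t :=
  (h.congr_left_right hf hs).seriesEq

theorem add_one_half_ne_intCast {u : ℝ} (hu : ∀ m : ℤ, u ≠ (2 * (m : ℝ) - 1) / 2) (m : ℤ) :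
    u + 1 / 2 ≠ m := fun h => hu m (by linear_combination h)

theorem odd_sq_sub_ne_zero {u : ℝ} (hu : ∀ m : ℤ, u + 1 / 2 ≠ m) (m : ℕ) :
    (2 * (m : ℝ) + 1) ^ 2 - 4 * u ^ 2 ≠ 0 := by
  intro h
  have : (2 * (m : ℝ) + 1 - 2 * u) * (2 * m + 1 + 2 * u) = 0 := by linear_combination h
  rcases mul_eq_zero.1 this with h | h
  · exact hu (m + 1) (by push_cast; linear_combination -h / 2)
  · exact hu (-m) (by push_cast; linear_combination h / 2)

theorem odd_pos (n : ℕ) : 0 < 2 * (n : ℝ) + 1 := by positivity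

theorem summable_norm_div_odd_sq {c : ℕ → ℝ} (hc : ∀ n, ‖c n‖ ≤ 1) :
    Summable fun n : ℕ => ‖c n / (2 * (n : ℝ) + 1) ^ 2‖ := by
  simpa using summable_norm_div_sq hc 2 1 two_ne_zero one_ne_zero

theorem summable_norm_div_odd_sq_sub {c : ℕ → ℝ} (hc : ∀ n, ‖c n‖ ≤ 1) (w : ℝ) :
    Summable fun n : ℕ => ‖c n / ((2 * (n : ℝ) + 1) ^ 2 - w)‖ :=
  summable_norm_div_sub (by simpa using tendsto_norm_sq_atTop (𝕜 := ℝ) 2 1 two_ne_zero)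
    (summable_norm_div_odd_sq hc) w

theorem norm_neg_one_pow_div_odd_le (n : ℕ) : ‖(-1) ^ n / (2 * (n : ℝ) + 1)‖ ≤ 1 := by
  rw [norm_div, norm_pow, norm_neg, norm_one, one_pow, Real.norm_of_nonneg (odd_pos n).le]
  exact div_le_one_of_le₀ (by linarith [(Nat.cast_nonneg n : (0 : ℝ) ≤ n)]) (odd_pos n).le

/-! ### The products tan·tanh and sec·sech. -/

variable {a x y : ℝ}

theorem hasSum_odd_inner (hx : x ≠ 0) (hy : y ≠ 0) (m : ℕ) :
    HasSum (fun n : ℕ => 1 / (x ^ 2 * (2 * (n : ℝ) + 1) ^ 2 + y ^ 2 * (2 * (m : ℝ) + 1) ^ 2))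
      (Real.pi * Real.tanh ((2 * (m : ℝ) + 1) / (2 * x) * Real.pi * y) /
        (4 * x * y * (2 * m + 1))) := by
  have hp := (odd_pos m).ne'
  have hv : y * (2 * m + 1) / (2 * x) ≠ 0 := by positivity
  refine ((Real.hasSum_tanh_pi hv).mul_left (1 / x ^ 2)).congr_left_right (fun n => ?_) ?_
  · rw [div_mul_div_comm]
    congr 1
    · norm_num
    · field_simp
      ring
  · rw [show Real.pi * (y * (2 * m + 1) / (2 * x)) = (2 * (m : ℝ) + 1) / (2 * x) * Real.pi * y by
      ring]
    generalize Real.tanh _ = t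
    field_simp
    ring

theorem hasSum_odd_char_inner (hx : x ≠ 0) (hy : y ≠ 0) (m : ℕ) :
    HasSum (fun n : ℕ => (-1) ^ n / (2 * (n : ℝ) + 1) /
        (x ^ 2 * (2 * (n : ℝ) + 1) ^ 2 + y ^ 2 * (2 * (m : ℝ) + 1) ^ 2))
      (Real.pi * (1 - 1 / Real.cosh ((2 * (m : ℝ) + 1) / (2 * x) * Real.pi * y)) /
        (4 * y ^ 2 * (2 * m + 1) ^ 2)) := by
  have hp := (odd_pos m).ne'
  have hv : y * (2 * m + 1) / (2 * x) ≠ 0 := by positivity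
  refine ((Real.hasSum_sech_pi hv).mul_left (1 / x ^ 2)).congr_left_right (fun n => ?_) ?_
  · have := (odd_pos n).ne'
    rw [div_div, div_mul_div_comm, one_mul]
    congr 1
    field_simp
    ring
  · rw [show Real.pi * (y * (2 * m + 1) / (2 * x)) = (2 * (m : ℝ) + 1) / (2 * x) * Real.pi * y by
      ring]
    generalize 1 / Real.cosh _ = t
    field_simp
    ring

theorem seriesEq_tan_mul_tanh (ha : a ≠ 0) (hx : x ≠ 0) (hy : y ≠ 0)
    (hu : ∀ m : ℤ, x * a ≠ (2 * (m : ℝ) - 1) / 2) :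
    SeriesEq (fun n : ℕ =>
        Real.pi * x ^ 2 * Real.tanh ((2 * (n : ℝ) - 1) / (2 * x) * Real.pi * y) /
            ((2 * (n : ℝ) - 1) * ((2 * (n : ℝ) - 1) ^ 2 - (2 * x * a) ^ 2))
          + Real.pi * y ^ 2 * Real.tanh ((2 * (n : ℝ) - 1) / (2 * y) * Real.pi * x) /
            ((2 * (n : ℝ) - 1) * ((2 * (n : ℝ) - 1) ^ 2 + (2 * y * a) ^ 2)))
      (Real.pi ^ 2 * Real.tan (Real.pi * x * a) * Real.tanh (Real.pi * y * a) / (16 * a ^ 2)) := by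
  have hu' := add_one_half_ne_intCast hu
  have h1 : ∀ n : ℕ, ‖(1 : ℝ)‖ ≤ 1 := fun _ => norm_one.le
  have e1 : 4 * (x * a) ^ 2 = 4 * a ^ 2 * x ^ 2 := by ring
  have e2 : 4 * (y * a) ^ 2 = 4 * a ^ 2 * y ^ 2 := by ring
  have hF := Real.hasSum_tan_pi (mul_ne_zero hx ha) hu'
  have hG := Real.hasSum_tanh_pi (mul_ne_zero hy ha)
  have hne := odd_sq_sub_ne_zero hu'
  simp only [e1, e2] at hF hG hne
  obtain ⟨S, T, hS, hT, hST⟩ := exists_hasSum_mul_eq_add (c := fun _ => 1) (d := fun _ => 1)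
    (P := fun n : ℕ => (2 * (n : ℝ) + 1) ^ 2) (Q := fun n : ℕ => (2 * (n : ℝ) + 1) ^ 2)
    (A := 4 * a ^ 2) (X := x ^ 2) (Y := y ^ 2) (by positivity) (by positivity)
    (fun m => by positivity) (fun m => by positivity) hne (fun n => by positivity)
    (summable_norm_div_odd_sq h1) (summable_norm_div_odd_sq h1)
    (summable_norm_div_odd_sq_sub h1 _)
    (by simpa using summable_norm_div_odd_sq_sub h1 (-(4 * a ^ 2 * y ^ 2)))
    hF hG (hasSum_odd_inner hx hy)
    (fun n => (hasSum_odd_inner hy hx n).congr_left_right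
      (fun m => by rw [add_comm (x ^ 2 * _)]) rfl)
  -- The factor 4xy clears the denominator 4xy(2n + 1) of the inner tanh sums, up to the odd factor
  -- that stays in the series.
  refine ((hS.add hT).mul_left (4 * x * y)).seriesEq_of_eq (fun n => ?_) ?_
  · have hp := (odd_pos n).ne'
    have hA := hne n
    have hB : (2 * (n : ℝ) + 1) ^ 2 + 4 * a ^ 2 * y ^ 2 ≠ 0 := by positivity
    rw [show (2 * ((n + 1 : ℕ) : ℝ) - 1) = 2 * n + 1 by push_cast; ring,
      show (2 * x * a) ^ 2 = 4 * a ^ 2 * x ^ 2 by ring,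
      show (2 * y * a) ^ 2 = 4 * a ^ 2 * y ^ 2 by ring]
    generalize Real.tanh ((2 * (n : ℝ) + 1) / (2 * x) * Real.pi * y) = t
    generalize Real.tanh ((2 * (n : ℝ) + 1) / (2 * y) * Real.pi * x) = t'
    generalize (2 * (n : ℝ) + 1) ^ 2 - 4 * a ^ 2 * x ^ 2 = U at *
    generalize (2 * (n : ℝ) + 1) ^ 2 + 4 * a ^ 2 * y ^ 2 = V at *
    generalize 2 * (n : ℝ) + 1 = p at hp
    field_simp
  · rw [← hST, ← mul_assoc, ← mul_assoc]
    field_simp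
    ring

/-- Both series are iterated sums of ∑ (−1)^(m+n)/(pq(x²q² + y²p²)) over odd p = 2m + 1 and q = 2n +
1, taken in the two orders. Their common value is the term that cancels in the sec·sech formula. -/
theorem exists_hasSum_odd_char_symm (hx : x ≠ 0) (hy : y ≠ 0) :
    ∃ K, HasSum (fun n : ℕ => (-1) ^ n / (2 * (n : ℝ) + 1) *
        (Real.pi * (1 - 1 / Real.cosh ((2 * (n : ℝ) + 1) / (2 * x) * Real.pi * y)) /
        (4 * y ^ 2 * (2 * n + 1) ^ 2))) K ∧
      HasSum (fun n : ℕ => (-1) ^ n / (2 * (n : ℝ) + 1) *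
        (Real.pi * (1 - 1 / Real.cosh ((2 * (n : ℝ) + 1) / (2 * y) * Real.pi * x)) /
        (4 * x ^ 2 * (2 * n + 1) ^ 2))) K := by
  have hs : Summable fun p : ℕ × ℕ => (-1) ^ p.1 / (2 * (p.1 : ℝ) + 1) *
      ((-1) ^ p.2 / (2 * (p.2 : ℝ) + 1) /
        (x ^ 2 * (2 * (p.2 : ℝ) + 1) ^ 2 + y ^ 2 * (2 * (p.1 : ℝ) + 1) ^ 2)) := by
    have h1 : ∀ n : ℕ, ‖(1 : ℝ)‖ ≤ 1 := fun _ => norm_one.le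
    have hb : Summable fun n : ℕ => ‖1 / (2 * |x * y|) * (1 / (2 * (n : ℝ) + 1) ^ 2)‖ := by
      simp_rw [norm_mul]
      exact (summable_norm_div_odd_sq h1).mul_left _
    refine summable_of_norm_le_mul (summable_norm_div_odd_sq h1) hb fun m n => ?_
    · have hm := odd_pos m
      have hn := odd_pos n
      generalize 2 * (m : ℝ) + 1 = p at *
      generalize 2 * (n : ℝ) + 1 = q at *
      have hxy : 0 < |x * y| := by positivity
      rw [norm_mul, norm_div, norm_div, norm_div, norm_pow, norm_pow, norm_neg, norm_one, one_pow,
        one_pow, Real.norm_of_nonneg hm.le, Real.norm_of_nonneg hn.le,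
        Real.norm_of_nonneg (r := x ^ 2 * q ^ 2 + y ^ 2 * p ^ 2) (by positivity),
        Real.norm_of_nonneg (r := 1 / p ^ 2) (by positivity),
        Real.norm_of_nonneg (r := 1 / (2 * |x * y|) * (1 / q ^ 2)) (by positivity)]
      -- The arithmetic-geometric mean inequality separates the variables and gives the summable
      -- majorant 1/(p²q²), up to a constant.
      have key : 2 * |x * y| * (p * q) ≤ x ^ 2 * q ^ 2 + y ^ 2 * p ^ 2 := by
        have := sq_nonneg (|x| * q - |y| * p)
        rw [abs_mul]
        nlinarith [sq_abs x, sq_abs y]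
      calc 1 / p * (1 / q / (x ^ 2 * q ^ 2 + y ^ 2 * p ^ 2))
          ≤ 1 / p * (1 / q / (2 * |x * y| * (p * q))) := by gcongr
        _ = 1 / p ^ 2 * (1 / (2 * |x * y|) * (1 / q ^ 2)) := by field_simp
  have hD := fun m : ℕ => (hasSum_odd_char_inner hx hy m).mul_left ((-1) ^ m / (2 * (m : ℝ) + 1))
  have hC := fun n : ℕ => (hasSum_odd_char_inner hy hx n).mul_left ((-1) ^ n / (2 * (n : ℝ) + 1))
  obtain ⟨K, -, h1, h2⟩ := exists_hasSum_fiberwise hs hD fun n =>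
    (hC n).congr_left_right (fun m => by rw [add_comm (x ^ 2 * _)]; ring) rfl
  exact ⟨K, h1, h2⟩

theorem exists_seriesEq_sec_mul_sech (ha : a ≠ 0) (hx : x ≠ 0) (hy : y ≠ 0)
    (hu : ∀ m : ℤ, x * a ≠ (2 * (m : ℝ) - 1) / 2) :
    ∃ S T : ℝ,
      SeriesEq (fun n : ℕ =>
        Real.pi * y ^ 2 * (-1) ^ n /
          ((2 * (n : ℝ) - 1) * ((2 * (n : ℝ) - 1) ^ 2 + (2 * y * a) ^ 2) *
            Real.cosh ((2 * (n : ℝ) - 1) / (2 * y) * Real.pi * x))) S ∧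
      SeriesEq (fun n : ℕ =>
        Real.pi * x ^ 2 * (-1) ^ n /
          ((2 * (n : ℝ) - 1) * ((2 * (n : ℝ) - 1) ^ 2 - (2 * x * a) ^ 2) *
            Real.cosh ((2 * (n : ℝ) - 1) / (2 * x) * Real.pi * y))) T ∧
      Real.pi ^ 2 /
          (16 * a ^ 2 * Real.cos (Real.pi * x * a) * Real.cosh (Real.pi * y * a))
        = Real.pi ^ 2 / (16 * a ^ 2) + S - T := by
  have hu' := add_one_half_ne_intCast hu
  have e1 : 4 * (x * a) ^ 2 = 4 * a ^ 2 * x ^ 2 := by ring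
  have e2 : 4 * (y * a) ^ 2 = 4 * a ^ 2 * y ^ 2 := by ring
  have hF := Real.hasSum_sec_pi (mul_ne_zero hx ha) hu'
  have hG := Real.hasSum_sech_pi (mul_ne_zero hy ha)
  have hne := odd_sq_sub_ne_zero hu'
  have h1 := norm_neg_one_pow_div_odd_le
  simp only [e1, e2, ← div_div ((-1 : ℝ) ^ _)] at hF hG hne
  obtain ⟨S, T, hS, hT, hST⟩ := exists_hasSum_mul_eq_add
    (c := fun n : ℕ => (-1) ^ n / (2 * (n : ℝ) + 1))
    (d := fun n : ℕ => (-1) ^ n / (2 * (n : ℝ) + 1))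
    (P := fun n : ℕ => (2 * (n : ℝ) + 1) ^ 2) (Q := fun n : ℕ => (2 * (n : ℝ) + 1) ^ 2)
    (A := 4 * a ^ 2) (X := x ^ 2) (Y := y ^ 2) (by positivity) (by positivity)
    (fun m => by positivity) (fun m => by positivity) hne (fun n => by positivity)
    (summable_norm_div_odd_sq h1) (summable_norm_div_odd_sq h1)
    (summable_norm_div_odd_sq_sub h1 _)
    (by simpa using summable_norm_div_odd_sq_sub h1 (-(4 * a ^ 2 * y ^ 2)))
    hF hG (hasSum_odd_char_inner hx hy)
    (fun n => (hasSum_odd_char_inner hy hx n).congr_left_right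
      (fun m => by rw [add_comm (x ^ 2 * _)]) rfl)
  obtain ⟨K, hK, hK'⟩ := exists_hasSum_odd_char_symm hx hy
  set F := Real.pi / (16 * (x * a) ^ 2) * (1 / Real.cos (Real.pi * (x * a)) - 1) with hFdef
  set G := Real.pi / (16 * (y * a) ^ 2) * (1 - 1 / Real.cosh (Real.pi * (y * a))) with hGdef
  -- These witnesses isolate the sech parts of the inner sums, which contain 1 − sech: the G and F
  -- terms remove the 1, and the K terms remove what the 1/p² part of the splitting leaves. K enters
  -- both with the same coefficient, so it drops out of the difference.
  refine ⟨-(Real.pi * y ^ 2 * G) + 4 * x ^ 2 * y ^ 2 * K - 16 * a ^ 2 * x ^ 2 * y ^ 2 * T,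
    -(Real.pi * x ^ 2 * F) + 4 * x ^ 2 * y ^ 2 * K + 16 * a ^ 2 * x ^ 2 * y ^ 2 * S, ?_, ?_, ?_⟩
  · refine (((hG.mul_left (Real.pi * y ^ 2)).neg.add (hK'.mul_left (4 * x ^ 2 * y ^ 2))).sub
      (hT.mul_left (16 * a ^ 2 * x ^ 2 * y ^ 2))).seriesEq_of_eq (fun n => ?_) rfl
    have hp := (odd_pos n).ne'
    have hB : (2 * (n : ℝ) + 1) ^ 2 + 4 * a ^ 2 * y ^ 2 ≠ 0 := by positivity
    rw [show (2 * ((n + 1 : ℕ) : ℝ) - 1) = 2 * n + 1 by push_cast; ring,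
      show (2 * y * a) ^ 2 = 4 * a ^ 2 * y ^ 2 by ring, pow_succ (-1 : ℝ) n, ← div_div _ _ (Real.cosh _),
      div_eq_mul_one_div _ (Real.cosh _)]
    -- Writing the constant as 4x²(V − p²), where V = p² + 4a²y², turns 1/(p²V) into a multiple of
    -- 1/p² − 1/V.
    rw [show 16 * a ^ 2 * x ^ 2 * y ^ 2
      = 4 * x ^ 2 * ((2 * (n : ℝ) + 1) ^ 2 + 4 * a ^ 2 * y ^ 2 - (2 * (n : ℝ) + 1) ^ 2) by ring]
    generalize 1 / Real.cosh ((2 * (n : ℝ) + 1) / (2 * y) * Real.pi * x) = t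
    generalize (2 * (n : ℝ) + 1) ^ 2 + 4 * a ^ 2 * y ^ 2 = V at hB
    generalize 2 * (n : ℝ) + 1 = p at hp
    field_simp
    ring
  · refine (((hF.mul_left (Real.pi * x ^ 2)).neg.add (hK.mul_left (4 * x ^ 2 * y ^ 2))).add
      (hS.mul_left (16 * a ^ 2 * x ^ 2 * y ^ 2))).seriesEq_of_eq (fun n => ?_) rfl
    have hp := (odd_pos n).ne'
    have hA := hne n
    rw [show (2 * ((n + 1 : ℕ) : ℝ) - 1) = 2 * n + 1 by push_cast; ring,
      show (2 * x * a) ^ 2 = 4 * a ^ 2 * x ^ 2 by ring, pow_succ (-1 : ℝ) n, ← div_div _ _ (Real.cosh _),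
      div_eq_mul_one_div _ (Real.cosh _)]
    rw [show 16 * a ^ 2 * x ^ 2 * y ^ 2
      = 4 * y ^ 2 * ((2 * (n : ℝ) + 1) ^ 2 - ((2 * (n : ℝ) + 1) ^ 2 - 4 * a ^ 2 * x ^ 2)) by ring]
    generalize 1 / Real.cosh ((2 * (n : ℝ) + 1) / (2 * x) * Real.pi * y) = t
    generalize (2 * (n : ℝ) + 1) ^ 2 - 4 * a ^ 2 * x ^ 2 = U at hA
    generalize 2 * (n : ℝ) + 1 = p at hp
    field_simp
    ring
  · rw [show Real.pi ^ 2 / (16 * a ^ 2 * Real.cos (Real.pi * x * a) * Real.cosh (Real.pi * y * a))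
      = Real.pi ^ 2 / (16 * a ^ 2) * (1 / Real.cos (Real.pi * (x * a))) *
        (1 / Real.cosh (Real.pi * (y * a))) by rw [mul_assoc _ x, mul_assoc _ y]; ring]
    have hc : 1 / Real.cos (Real.pi * (x * a)) = 1 + 16 * (x * a) ^ 2 / Real.pi * F := by
      rw [hFdef]
      generalize 1 / Real.cos _ = t
      field_simp [Real.pi_ne_zero]
      ring
    have hh : 1 / Real.cosh (Real.pi * (y * a)) = 1 - 16 * (y * a) ^ 2 / Real.pi * G := by
      rw [hGdef]
      generalize 1 / Real.cosh _ = t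
      field_simp [Real.pi_ne_zero]
      ring
    rw [hc, hh]
    have hpi := Real.pi_ne_zero
    have e : Real.pi ^ 2 / (16 * a ^ 2) * (1 + 16 * (x * a) ^ 2 / Real.pi * F) *
        (1 - 16 * (y * a) ^ 2 / Real.pi * G) = Real.pi ^ 2 / (16 * a ^ 2) + Real.pi * x ^ 2 * F
          - Real.pi * y ^ 2 * G - 16 * a ^ 2 * x ^ 2 * y ^ 2 * (F * G) := by
      field_simp
      ring
    rw [e, hST]
    ring

/-! ### Decay of csch and of coth minus its limit. -/

theorem div_sinh_le {t s : ℝ} (ht : 0 < t) (hs : t ≤ s) :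
    1 / Real.sinh s ≤ 2 / (1 - Real.exp (-2 * t)) * Real.exp (-s) := by
  have h1 : 0 < 1 - Real.exp (-2 * t) := by
    rw [sub_pos, Real.exp_lt_one_iff]; linarith
  have h2 : Real.exp (-2 * s) ≤ Real.exp (-2 * t) := Real.exp_le_exp.2 (by linarith)
  have h3 : Real.sinh s = Real.exp s * (1 - Real.exp (-2 * s)) / 2 := by
    rw [Real.sinh_eq, mul_sub, ← Real.exp_add]
    ring_nf
  have h4 : Real.exp s * (1 - Real.exp (-2 * t)) / 2 ≤ Real.sinh s := by
    rw [h3]; gcongr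
  calc 1 / Real.sinh s ≤ 1 / (Real.exp s * (1 - Real.exp (-2 * t)) / 2) := by
        gcongr
    _ = 2 / (1 - Real.exp (-2 * t)) * Real.exp (-s) := by
        rw [Real.exp_neg]
        field_simp

theorem abs_sinh_eq (s : ℝ) : |Real.sinh s| = Real.sinh |s| := by
  rcases le_total 0 s with h | h
  · rw [abs_of_nonneg h, abs_of_nonneg (Real.sinh_nonneg_iff.2 h)]
  · rw [abs_of_nonpos h, abs_of_nonpos (Real.sinh_nonpos_iff.2 h), Real.sinh_neg]

theorem summable_norm_one_div_sinh {t : ℝ} (ht : t ≠ 0) :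
    Summable fun n : ℕ => ‖1 / Real.sinh (t * ((n : ℝ) + 1))‖ := by
  have ht' : 0 < |t| := abs_pos.2 ht
  have hg : Summable fun n : ℕ => Real.exp (-|t|) ^ n :=
    summable_geometric_of_lt_one (Real.exp_pos _).le (by rw [Real.exp_lt_one_iff]; linarith)
  refine (hg.mul_left (2 / (1 - Real.exp (-2 * |t|)) * Real.exp (-|t|))).of_nonneg_of_le
    (fun _ => norm_nonneg _) fun n => ?_
  have hn : (0 : ℝ) ≤ n := n.cast_nonneg
  have hs : |t * ((n : ℝ) + 1)| = |t| * (n + 1) := by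
    rw [abs_mul, abs_of_nonneg (by positivity : (0 : ℝ) ≤ n + 1)]
  rw [norm_div, norm_one, Real.norm_eq_abs, abs_sinh_eq, hs]
  refine (div_sinh_le ht' (by nlinarith)).trans_eq ?_
  rw [mul_assoc, ← Real.exp_nat_mul, ← Real.exp_add]
  ring_nf

/-- For s > 0, cosh s − sinh s = e^(−s) ≤ 1; negative s follows by oddness. -/
theorem abs_coth_sub_sign_le {s : ℝ} (hs : s ≠ 0) :
    |Real.cosh s / Real.sinh s - SignType.sign s| ≤ |1 / Real.sinh s| := by
  have key : ∀ s : ℝ, 0 < s → |Real.cosh s / Real.sinh s - 1| ≤ |1 / Real.sinh s| := by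
    intro s hs
    have h := Real.sinh_pos_iff.2 hs
    rw [div_sub_one h.ne', Real.cosh_sub_sinh, abs_div, abs_div, abs_one,
      abs_of_pos (Real.exp_pos _)]
    gcongr
    exact Real.exp_le_one_iff.2 (by linarith)
  rcases hs.lt_or_gt with h | h
  · have := key (-s) (by linarith)
    rw [Real.cosh_neg, Real.sinh_neg, div_neg, div_neg, abs_neg, ← abs_neg] at this
    rw [sign_neg h]
    simpa [add_comm] using this
  · rw [sign_pos h]
    simpa using key s h

theorem summable_norm_coth_sub {t : ℝ} (ht : t ≠ 0) :
    Summable fun n : ℕ => ‖Real.cosh (t * ((n : ℝ) + 1)) / Real.sinh (t * ((n : ℝ) + 1))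
      - (SignType.sign t : ℝ)‖ := by
  refine (summable_norm_one_div_sinh ht).of_nonneg_of_le (fun _ => norm_nonneg _) fun n => ?_
  have hn : (0 : ℝ) < n + 1 := by positivity
  have := abs_coth_sub_sign_le (mul_ne_zero ht hn.ne')
  rwa [sign_mul, sign_pos hn, mul_one] at this

theorem tendsto_one_div_sinh {ι : Type*} {l : Filter ι} {s : ι → ℝ}
    (hs : Tendsto (fun i => |s i|) l atTop) : Tendsto (fun i => 1 / Real.sinh (s i)) l (𝓝 0) := by
  rw [tendsto_zero_iff_norm_tendsto_zero]
  refine squeeze_zero (fun _ => norm_nonneg _) (g := fun i => 1 / |s i|) (fun i => ?_)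
    (tendsto_const_nhds.div_atTop hs)
  rw [norm_div, norm_one, Real.norm_eq_abs, abs_sinh_eq]
  rcases (abs_nonneg (s i)).eq_or_lt with h | h
  · simp [← h]
  · gcongr
    exact Real.self_le_sinh_iff.2 h.le

/-! ### The alternating series ∑ (−1)ⁿ n/(n² + q), its limit as q → ∞, and its version with a
kernel. -/

section Alternating

/-- The increments of `k ↦ k / (k ^ 2 + q)`, with alternating signs. -/
noncomputable def altIncrement (q : ℝ) (n : ℕ) : ℝ :=
  (-1) ^ (n + 1) * (((n : ℝ) + 1) / (((n : ℝ) + 1) ^ 2 + q) - n / ((n : ℝ) ^ 2 + q))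

theorem norm_altIncrement_le {q : ℝ} (hq : 0 ≤ q) (n : ℕ) :
    ‖altIncrement q n‖ ≤ 4 * (1 / ((n : ℝ) + 1) ^ 2) := by
  rw [altIncrement, norm_mul, norm_pow, norm_neg, norm_one, one_pow, one_mul, Real.norm_eq_abs]
  rcases n.eq_zero_or_pos with rfl | hn
  · simp only [Nat.cast_zero, zero_add, zero_div, sub_zero, one_pow]
    rw [abs_of_nonneg (by positivity), div_le_iff₀ (by positivity)]
    linarith
  · have hn' : (1 : ℝ) ≤ n := by exact_mod_cast hn
    rw [div_sub_div _ _ (by positivity) (by positivity), abs_div,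
      abs_of_pos (by positivity : 0 < (((n : ℝ) + 1) ^ 2 + q) * ((n : ℝ) ^ 2 + q)), mul_one_div,
      div_le_div_iff₀ (by positivity) (by positivity)]
    have h1 : |((n : ℝ) + 1) * ((n : ℝ) ^ 2 + q) - (((n : ℝ) + 1) ^ 2 + q) * n|
        ≤ ((n : ℝ) + 1) ^ 2 + q := by
      rw [abs_le]; constructor <;> nlinarith
    have h2 : ((n : ℝ) + 1) ^ 2 ≤ 4 * ((n : ℝ) ^ 2 + q) := by nlinarith
    calc _ ≤ (((n : ℝ) + 1) ^ 2 + q) * (4 * ((n : ℝ) ^ 2 + q)) := by gcongr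
      _ = _ := by ring

theorem summable_one_div_succ_sq : Summable fun n : ℕ => 1 / ((n : ℝ) + 1) ^ 2 := by
  simpa using summable_norm_div_sq (𝕜 := ℝ) (c := fun _ => 1) (by simp) 1 1 one_ne_zero one_ne_zero

/-- With a_n = n/(n² + q) and a_0 = 0, adding consecutive terms (−1)^(n+1)a_(n+1) + (−1)ⁿa_n gives
twice the partial sum, minus the last term, which tends to 0. The conditionally convergent series
thus becomes half an absolutely convergent one. At q = 0 the value a_0 = 0 is the convention 0/0 =
0. -/
theorem seriesEq_alternating {q : ℝ} (hq : 0 ≤ q) :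
    SeriesEq (fun n : ℕ => (-1) ^ n * (n / ((n : ℝ) ^ 2 + q))) ((∑' n, altIncrement q n) / 2) := by
  have hs : Summable (altIncrement q) :=
    Summable.of_norm_bounded (summable_one_div_succ_sq.mul_left 4) (norm_altIncrement_le hq)
  have hlim : Tendsto (fun N : ℕ => (-1) ^ N * ((N : ℝ) / ((N : ℝ) ^ 2 + q))) atTop (𝓝 0) := by
    rw [tendsto_zero_iff_norm_tendsto_zero]
    refine squeeze_zero (fun _ => norm_nonneg _) (g := fun N : ℕ => 1 / (N : ℝ)) (fun N => ?_)
      tendsto_one_div_atTop_nhds_zero_nat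
    rw [norm_mul, norm_pow, norm_neg, norm_one, one_pow, one_mul,
      Real.norm_of_nonneg (by positivity)]
    rcases N.eq_zero_or_pos with rfl | hN
    · simp
    · have : (0 : ℝ) < N := by exact_mod_cast hN
      rw [div_le_div_iff₀ (by positivity) this]
      nlinarith
  have := (hs.hasSum.tendsto_sum_nat.add hlim).div_const 2
  rw [add_zero] at this
  refine this.congr fun N => ?_
  induction N with
  | zero => simp
  | succ N ih =>
    rw [Finset.sum_Icc_succ_top (by omega), ← ih, Finset.sum_range_succ, altIncrement, pow_succ]
    push_cast
    ring

/-- Dominated convergence: the bound 4/(n + 1)² on the increments is uniform in q. No such bound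
exists for the original conditionally convergent series. -/
theorem tendsto_tsum_altIncrement {ι : Type*} {l : Filter ι} {q : ι → ℝ} (hq : ∀ i, 0 ≤ q i)
    (hl : Tendsto q l atTop) : Tendsto (fun i => ∑' n, altIncrement (q i) n) l (𝓝 0) := by
  have := tendsto_tsum_of_dominated_convergence (f := fun i n => altIncrement (q i) n)
    (g := fun _ => 0) (𝓕 := l) (summable_one_div_succ_sq.mul_left 4) (fun n => ?_)
    (Eventually.of_forall fun i n => norm_altIncrement_le (hq i) n)
  · simpa using this
  · have h (k : ℝ) : Tendsto (fun i => k / (k ^ 2 + q i)) l (𝓝 0) :=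
      tendsto_const_nhds.div_atTop (tendsto_atTop_add_const_left _ _ hl)
    simpa [altIncrement] using ((h (n + 1)).sub (h n)).const_mul ((-1) ^ (n + 1))

end Alternating

theorem SeriesEq.add {f g : ℕ → ℝ} {s t : ℝ} (hf : SeriesEq f s) (hg : SeriesEq g t) :
    SeriesEq (fun n => f n + g n) (s + t) := by
  refine (Tendsto.add hf hg).congr fun N => ?_
  rw [Finset.sum_add_distrib]

theorem SeriesEq.sub {f g : ℕ → ℝ} {s t : ℝ} (hf : SeriesEq f s) (hg : SeriesEq g t) :
    SeriesEq (fun n => f n - g n) (s - t) := by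
  refine (Tendsto.sub hf hg).congr fun N => ?_
  rw [Finset.sum_sub_distrib]

theorem SeriesEq.const_mul {f : ℕ → ℝ} {s : ℝ} (r : ℝ) (hf : SeriesEq f s) :
    SeriesEq (fun n => r * f n) (r * s) := by
  refine (Tendsto.const_mul r hf).congr fun N => ?_
  rw [Finset.mul_sum]

theorem SeriesEq.unique {f : ℕ → ℝ} {s t : ℝ} (hs : SeriesEq f s) (ht : SeriesEq f t) : s = t :=
  tendsto_nhds_unique hs ht

theorem SeriesEq.congr {f g : ℕ → ℝ} {s : ℝ} (hf : SeriesEq f s)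
    (h : ∀ n : ℕ, f (n + 1) = g (n + 1)) : SeriesEq g s := by
  refine Tendsto.congr (fun N => Finset.sum_congr rfl fun n hn => ?_) hf
  obtain ⟨m, rfl⟩ := Nat.exists_eq_succ_of_ne_zero (Nat.one_le_iff_ne_zero.1 (Finset.mem_Icc.1 hn).1)
  exact h m

/-- The sum of `(-1) ^ n * n / (n ^ 2 + q) * κ n`, where `κ n` tends to `σ`. -/
noncomputable def altKernelSum (κ : ℕ → ℝ) (σ q : ℝ) : ℝ :=
  σ * ((∑' n, altIncrement q n) / 2) +
    ∑' n : ℕ, (-1) ^ (n + 1) * (((n : ℝ) + 1) / (((n : ℝ) + 1) ^ 2 + q)) * (κ (n + 1) - σ)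

section AltKernel

variable {κ : ℕ → ℝ} {σ : ℝ}

theorem norm_altKernel_le {q : ℝ} (hq : 0 ≤ q) (n : ℕ) (r : ℝ) :
    ‖(-1) ^ (n + 1) * (((n : ℝ) + 1) / (((n : ℝ) + 1) ^ 2 + q)) * r‖ ≤ ‖r‖ := by
  rw [norm_mul, norm_mul, norm_pow, norm_neg, norm_one, one_pow, one_mul,
    Real.norm_of_nonneg (r := ((n : ℝ) + 1) / _) (by positivity)]
  refine mul_le_of_le_one_left (norm_nonneg _) (div_le_one_of_le₀ ?_ (by positivity))
  nlinarith [(n.cast_nonneg : (0 : ℝ) ≤ n)]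

/-- Only the constant σ is conditionally summed; the deviation κ − σ is summable and its
coefficients are at most 1 in absolute value. -/
theorem seriesEq_altKernel (hκ : Summable fun n => ‖κ (n + 1) - σ‖) {q : ℝ} (hq : 0 ≤ q) :
    SeriesEq (fun n : ℕ => (-1) ^ n * (n / ((n : ℝ) ^ 2 + q)) * κ n) (altKernelSum κ σ q) := by
  have h1 := (seriesEq_alternating hq).const_mul σ
  have h2 : SeriesEq (fun n : ℕ => (-1) ^ n * (n / ((n : ℝ) ^ 2 + q)) * (κ n - σ)) _ :=
    (Summable.of_norm_bounded hκ fun n =>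
      norm_altKernel_le hq n (κ (n + 1) - σ)).hasSum.seriesEq_of_eq (fun n => by push_cast; rfl) rfl
  exact (h1.add h2).congr fun n => by ring

theorem tendsto_altKernelSum (hκ : Summable fun n => ‖κ (n + 1) - σ‖) {ι : Type*} {l : Filter ι}
    {q : ι → ℝ} (hq : ∀ i, 0 ≤ q i) (hl : Tendsto q l atTop) :
    Tendsto (fun i => altKernelSum κ σ (q i)) l (𝓝 0) := by
  have h1 := ((tendsto_tsum_altIncrement hq hl).div_const 2).const_mul σ
  have h2 := tendsto_tsum_of_dominated_convergence (𝓕 := l) (g := fun _ => 0)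
    (f := fun i (n : ℕ) => (-1) ^ (n + 1) * (((n : ℝ) + 1) / (((n : ℝ) + 1) ^ 2 + q i)) *
      (κ (n + 1) - σ)) hκ (fun n => ?_)
    (Eventually.of_forall fun i n => norm_altKernel_le (hq i) n (κ (n + 1) - σ))
  · simpa [altKernelSum] using h1.add h2
  · have h : Tendsto (fun i => ((n : ℝ) + 1) / (((n : ℝ) + 1) ^ 2 + q i)) l (𝓝 0) :=
      tendsto_const_nhds.div_atTop (tendsto_atTop_add_const_left _ _ hl)
    simpa using (h.const_mul ((-1) ^ (n + 1))).mul_const (κ (n + 1) - σ)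

end AltKernel

/-- The sum of `n / (n ^ 2 - q) * s n`. -/
noncomputable def poleSum (s : ℕ → ℝ) (q : ℝ) : ℝ :=
  ∑' n : ℕ, (((n : ℝ) + 1) / (((n : ℝ) + 1) ^ 2 - q)) * s (n + 1)

/-! ### The sum with real poles, and its limit along half-integers. -/

section Pole

variable {s : ℕ → ℝ}

theorem tendsto_norm_succ_sq : Tendsto (fun n : ℕ => ‖((n : ℝ) + 1) ^ 2‖) atTop atTop := by
  simpa using tendsto_norm_sq_atTop (𝕜 := ℝ) 1 1 one_ne_zero

theorem hasSum_poleSum (hs : Summable fun n => ‖s (n + 1)‖) (q : ℝ) :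
    HasSum (fun n : ℕ => (((n : ℝ) + 1) / (((n : ℝ) + 1) ^ 2 - q)) * s (n + 1)) (poleSum s q) := by
  have h : Summable fun n : ℕ => ‖((n : ℝ) + 1) * s (n + 1) / ((n : ℝ) + 1) ^ 2‖ := by
    refine hs.of_nonneg_of_le (fun _ => norm_nonneg _) fun n => ?_
    have hn : (0 : ℝ) < n + 1 := by positivity
    rw [pow_two, mul_div_mul_left _ _ hn.ne', norm_div, Real.norm_of_nonneg hn.le]
    exact div_le_self (norm_nonneg _) (by linarith [(n.cast_nonneg : (0 : ℝ) ≤ n)])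
  refine Summable.hasSum ((summable_norm_div_sub tendsto_norm_succ_sq h q).of_norm.congr
    fun n => ?_)
  ring

/-- A half-integer stays at distance at least 1/2 from every integer k = n + 1, while k + j + 1/2 ≥
k. The bound, uniform in j, permits dominated convergence. -/
theorem norm_pole_le (j n : ℕ) :
    ‖((n : ℝ) + 1) / (((n : ℝ) + 1) ^ 2 - ((j : ℝ) + 1 / 2) ^ 2)‖ ≤ 2 := by
  have hn : (0 : ℝ) < n + 1 := by positivity
  have hj : (0 : ℝ) ≤ j := j.cast_nonneg
  have h1 : 1 / 2 ≤ |(n : ℝ) + 1 - (j + 1 / 2)| := by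
    rcases le_or_gt j n with h | h
    · have : (j : ℝ) ≤ n := by exact_mod_cast h
      exact le_abs.2 (Or.inl (by linarith))
    · have : (n : ℝ) + 1 ≤ j := by exact_mod_cast h
      exact le_abs.2 (Or.inr (by linarith))
  have h2 : (n : ℝ) + 1 + (j + 1 / 2) ≥ n + 1 := by linarith
  rw [sq_sub_sq, norm_div, norm_mul, Real.norm_of_nonneg hn.le,
    Real.norm_of_nonneg (by linarith : 0 ≤ (n : ℝ) + 1 + (j + 1 / 2)), Real.norm_eq_abs,
    div_le_iff₀ (by positivity)]
  nlinarith

theorem tendsto_poleSum (hs : Summable fun n => ‖s (n + 1)‖) :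
    Tendsto (fun j : ℕ => poleSum s (((j : ℝ) + 1 / 2) ^ 2)) atTop (𝓝 0) := by
  have := tendsto_tsum_of_dominated_convergence (𝓕 := atTop) (g := fun _ => 0)
    (f := fun (j n : ℕ) => (((n : ℝ) + 1) / (((n : ℝ) + 1) ^ 2 - ((j : ℝ) + 1 / 2) ^ 2)) *
      s (n + 1)) (hs.mul_left 2) (fun n => ?_)
    (Eventually.of_forall fun j n => ?_)
  · simpa [poleSum] using this
  · have hl : Tendsto (fun j : ℕ => ((j : ℝ) + 1 / 2) ^ 2) atTop atTop :=
      (tendsto_pow_atTop two_ne_zero).comp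
        (tendsto_atTop_add_const_right _ _ tendsto_natCast_atTop_atTop)
    have h : Tendsto (fun j : ℕ => ((n : ℝ) + 1) / (((n : ℝ) + 1) ^ 2 - ((j : ℝ) + 1 / 2) ^ 2))
        atTop (𝓝 0) := by
      have h' : Tendsto (fun j : ℕ => ((j : ℝ) + 1 / 2) ^ 2 + -((n : ℝ) + 1) ^ 2) atTop atTop :=
        tendsto_atTop_add_const_right _ _ hl
      have := (tendsto_const_nhds (x := -((n : ℝ) + 1))).div_atTop h'
      refine this.congr fun j => ?_
      rw [← neg_div_neg_eq]
      ring_nf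
    simpa using h.mul_const (s (n + 1))
  · rw [norm_mul]
    exact mul_le_mul_of_nonneg_right (norm_pole_le j n) (norm_nonneg _)

end Pole

/-! ### Products with csch, up to a constant. -/

theorem summable_norm_div_succ_sq {c : ℕ → ℝ} (hc : ∀ n, ‖c n‖ ≤ 1) :
    Summable fun n : ℕ => ‖c n / ((n : ℝ) + 1) ^ 2‖ := by
  simpa using summable_norm_div_sq hc 1 1 one_ne_zero one_ne_zero

theorem sq_sub_ne_zero_of_ne_intCast {u : ℝ} (hu : ∀ m : ℤ, u ≠ m) (m : ℕ) :
    ((m : ℝ) + 1) ^ 2 - u ^ 2 ≠ 0 := by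
  intro h
  have : ((m : ℝ) + 1 - u) * (m + 1 + u) = 0 := by linear_combination h
  rcases mul_eq_zero.1 this with h | h
  · exact hu (m + 1) (by push_cast; linear_combination -h)
  · exact hu (-(m + 1)) (by push_cast; linear_combination h)

/-- Rescaling by v = y(m + 1)/x. An abstract pair (c, κ) treats csch, with alternating signs, and
coth, with constant signs, together. -/
theorem hasSum_inner_of_kernel {c : ℕ → ℝ} {κ : ℝ → ℝ} (hκ : ∀ v : ℝ, v ≠ 0 →
      HasSum (fun m : ℕ => c m / (((m : ℝ) + 1) ^ 2 + v ^ 2)) ((Real.pi * κ v - 1 / v) / (2 * v)))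
    {x y : ℝ} (hx : x ≠ 0) (hy : y ≠ 0) (m : ℕ) :
    HasSum (fun n : ℕ => c n / (x ^ 2 * ((n : ℝ) + 1) ^ 2 + y ^ 2 * ((m : ℝ) + 1) ^ 2))
      ((Real.pi * κ (y * (m + 1) / x) - x / (y * (m + 1))) / (2 * x * y * (m + 1))) := by
  have hp : (m : ℝ) + 1 ≠ 0 := by positivity
  have hv : y * (m + 1) / x ≠ 0 := by positivity
  refine ((hκ _ hv).mul_left (1 / x ^ 2)).congr_left_right (fun n => ?_) ?_
  · rw [div_mul_div_comm, one_mul]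
    congr 1
    field_simp
  · rw [one_div_div]
    field_simp

/-- The subtracted 1/(n + 1) comes from AX/(P(P − AX)) = 1/(P − AX) − 1/P, and its analogue for Q,
applied to the product series. It keeps both sums absolutely convergent even when κ does not decay;
it is also the value at a = 0, so it contributes only an a-free constant. -/
theorem exists_hasSum_csch_product {c : ℕ → ℝ} {κ : ℝ → ℝ} {φ a x y : ℝ} (hc : ∀ n, ‖c n‖ ≤ 1)
    (hκ : ∀ v : ℝ, v ≠ 0 →
      HasSum (fun m : ℕ => c m / (((m : ℝ) + 1) ^ 2 + v ^ 2)) ((Real.pi * κ v - 1 / v) / (2 * v)))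
    (ha : a ≠ 0) (hx : x ≠ 0) (hy : y ≠ 0) (hu : ∀ m : ℤ, x * a ≠ m)
    (hφ : HasSum (fun m : ℕ => c m / (((m : ℝ) + 1) ^ 2 - (x * a) ^ 2))
      ((1 / (x * a) - Real.pi * φ) / (2 * (x * a)))) :
    ∃ S T : ℝ,
      HasSum (fun n : ℕ => (((n : ℝ) + 1) / (((n : ℝ) + 1) ^ 2 - (x * a) ^ 2) - 1 / ((n : ℝ) + 1)) *
        (c n * (1 / Real.sinh (Real.pi * (y * (n + 1) / x))))) S ∧
      HasSum (fun n : ℕ => (-1) ^ (n + 1) * (((n : ℝ) + 1) / (((n : ℝ) + 1) ^ 2 + (y * a) ^ 2)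
        - 1 / ((n : ℝ) + 1)) * κ (x * (n + 1) / y)) T ∧
      Real.pi ^ 2 * φ / Real.sinh (Real.pi * (y * a)) = 1 / (a ^ 2 * x * y) +
        2 * Real.pi * (T - S) + (2 * (y / x) * (∑' n : ℕ, (-1) ^ (n + 1) / ((n : ℝ) + 1) ^ 2) -
          2 * (x / y) * ∑' n : ℕ, c n / ((n : ℝ) + 1) ^ 2) := by
  have hne := sq_sub_ne_zero_of_ne_intCast hu
  have hd : ∀ n : ℕ, ‖(-1 : ℝ) ^ (n + 1)‖ ≤ 1 := fun n => by simp
  have hG := Real.hasSum_csch_pi (mul_ne_zero hy ha)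
  have e1 : (x * a) ^ 2 = a ^ 2 * x ^ 2 := by ring
  have e2 : (y * a) ^ 2 = a ^ 2 * y ^ 2 := by ring
  simp only [e1, e2] at hφ hG hne ⊢
  have hd' := summable_norm_div_sub tendsto_norm_succ_sq (summable_norm_div_succ_sq hd)
    (-(a ^ 2 * y ^ 2))
  have hZ := (summable_norm_div_succ_sq hd).of_norm.hasSum
  have hZc := (summable_norm_div_succ_sq hc).of_norm.hasSum
  obtain ⟨S, T, hS, hT, hST⟩ := exists_hasSum_mul_eq_add (c := c)
    (d := fun n : ℕ => (-1) ^ (n + 1))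
    (P := fun n : ℕ => ((n : ℝ) + 1) ^ 2) (Q := fun n : ℕ => ((n : ℝ) + 1) ^ 2)
    (A := a ^ 2) (X := x ^ 2) (Y := y ^ 2) (by positivity) (by positivity)
    (fun m => by positivity) (fun m => by positivity) hne (fun n => by positivity)
    (summable_norm_div_succ_sq hc) (summable_norm_div_succ_sq hd)
    (summable_norm_div_sub tendsto_norm_succ_sq (summable_norm_div_succ_sq hc) _)
    (by simpa using hd')
    hφ hG (hasSum_inner_of_kernel (κ := fun v => 1 / Real.sinh (Real.pi * v))
      (fun v hv => Real.hasSum_csch_pi hv) hx hy)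
    (fun n => (hasSum_inner_of_kernel hκ hy hx n).congr_left_right
      (fun m => by rw [add_comm (x ^ 2 * _)]) rfl)
  set F := (1 / (x * a) - Real.pi * φ) / (2 * (x * a)) with hFdef
  set G := (Real.pi * (1 / Real.sinh (Real.pi * (y * a))) - 1 / (y * a)) / (2 * (y * a)) with hGdef
  set Z := ∑' n : ℕ, (-1) ^ (n + 1) / ((n : ℝ) + 1) ^ 2
  set Zc := ∑' n : ℕ, c n / ((n : ℝ) + 1) ^ 2
  have hpi := Real.pi_ne_zero
  -- The F, G, Z and Zc terms cancel the contribution of the elementary part 1/v of the inner sums,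
  -- leaving only the kernels.
  refine ⟨(4 * a ^ 2 * x * y * S + 2 * (x / y) * F - 2 * (x / y) * Zc) / (2 * Real.pi),
    (-(4 * a ^ 2 * x * y * T) - 2 * (y / x) * Z + 2 * (y / x) * G) / (2 * Real.pi), ?_, ?_, ?_⟩
  · refine ((((hS.mul_left (4 * a ^ 2 * x * y)).add (hφ.mul_left (2 * (x / y)))).sub
      (hZc.mul_left (2 * (x / y)))).div_const (2 * Real.pi)).congr_left_right (fun n => ?_) rfl
    have hp : (n : ℝ) + 1 ≠ 0 := by positivity
    have hA := hne n
    rw [show 4 * a ^ 2 * x * y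
      = 4 * (y / x) * (((n : ℝ) + 1) ^ 2 - (((n : ℝ) + 1) ^ 2 - a ^ 2 * x ^ 2)) by field_simp; ring]
    generalize 1 / Real.sinh (Real.pi * (y * (n + 1) / x)) = t
    generalize ((n : ℝ) + 1) ^ 2 - a ^ 2 * x ^ 2 = U at hA
    generalize (n : ℝ) + 1 = p at hp
    field_simp
    ring
  · refine ((((hT.mul_left (4 * a ^ 2 * x * y)).neg.sub (hZ.mul_left (2 * (y / x)))).add
      (hG.mul_left (2 * (y / x)))).div_const (2 * Real.pi)).congr_left_right (fun n => ?_) rfl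
    have hp : (n : ℝ) + 1 ≠ 0 := by positivity
    have hB : ((n : ℝ) + 1) ^ 2 + a ^ 2 * y ^ 2 ≠ 0 := by positivity
    rw [show 4 * a ^ 2 * x * y
      = 4 * (x / y) * ((((n : ℝ) + 1) ^ 2 + a ^ 2 * y ^ 2) - ((n : ℝ) + 1) ^ 2) by field_simp; ring]
    generalize κ (x * (n + 1) / y) = t
    generalize ((n : ℝ) + 1) ^ 2 + a ^ 2 * y ^ 2 = V at hB
    generalize (n : ℝ) + 1 = p at hp
    field_simp
    ring
  · have h1 : Real.pi * φ = 1 / (x * a) - 2 * (x * a) * F := by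
      rw [hFdef]; field_simp; ring
    have h2 : Real.pi * (1 / Real.sinh (Real.pi * (y * a))) = 1 / (y * a) + 2 * (y * a) * G := by
      rw [hGdef]
      generalize 1 / Real.sinh _ = t
      field_simp
      ring
    calc Real.pi ^ 2 * φ / Real.sinh (Real.pi * (y * a))
        = (Real.pi * φ) * (Real.pi * (1 / Real.sinh (Real.pi * (y * a)))) := by ring
      _ = 1 / (a ^ 2 * x * y) - 2 * (x / y) * F + 2 * (y / x) * G
          - 4 * a ^ 2 * x * y * (F * G) := by
        rw [h1, h2]
        field_simp
        ring
      _ = _ := by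
        rw [hST]
        field_simp
        ring

theorem natCast_add_one_half_ne_intCast (j : ℕ) (m : ℤ) : (j : ℝ) + 1 / 2 ≠ m := by
  intro h
  have : ((2 * j + 1 : ℤ) : ℝ) = ((2 * m : ℤ) : ℝ) := by push_cast; linear_combination 2 * h
  have : (2 * j + 1 : ℤ) = 2 * m := by exact_mod_cast this
  omega

section CschProduct

variable {c : ℕ → ℝ} {κ φ : ℝ → ℝ} {σ x y : ℝ}

theorem summable_norm_mul_csch (hc : ∀ n, ‖c n‖ ≤ 1) (hx : x ≠ 0) (hy : y ≠ 0) :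
    Summable fun n : ℕ =>
      ‖c (n + 1) * (1 / Real.sinh (Real.pi * (y * ((n + 1 : ℕ) : ℝ) / x)))‖ := by
  have h := summable_norm_one_div_sinh
    (div_ne_zero (mul_ne_zero Real.pi_ne_zero hy) hx : Real.pi * y / x ≠ 0)
  refine h.of_nonneg_of_le (fun _ => norm_nonneg _) fun n => ?_
  rw [norm_mul, show Real.pi * (y * ((n + 1 : ℕ) : ℝ) / x) = Real.pi * y / x * ((n : ℝ) + 1) by
    push_cast; ring]
  exact mul_le_of_le_one_left (norm_nonneg _) (hc _)

/-- The expansion of `φ (x a) / sinh (π y a)` up to a constant that does not depend on `a`. -/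
theorem exists_csch_product_eq_add_const (hc : ∀ n, ‖c n‖ ≤ 1)
    (hκ : ∀ v : ℝ, v ≠ 0 → HasSum (fun m : ℕ => c (m + 1) / (((m : ℝ) + 1) ^ 2 + v ^ 2))
      ((Real.pi * κ v - 1 / v) / (2 * v)))
    (hφ : ∀ u : ℝ, (∀ m : ℤ, u ≠ m) →
      HasSum (fun m : ℕ => c (m + 1) / (((m : ℝ) + 1) ^ 2 - u ^ 2))
        ((1 / u - Real.pi * φ u) / (2 * u)))
    (hx : x ≠ 0) (hy : y ≠ 0)
    (hσ : Summable fun n : ℕ => ‖κ (x * ((n + 1 : ℕ) : ℝ) / y) - σ‖) :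
    ∃ K : ℝ, ∀ a : ℝ, a ≠ 0 → (∀ m : ℤ, x * a ≠ m) →
      Real.pi ^ 2 * φ (x * a) / Real.sinh (Real.pi * (y * a)) = 1 / (a ^ 2 * x * y) +
        2 * Real.pi * (altKernelSum (fun n => κ (x * n / y)) σ ((y * a) ^ 2) -
          poleSum (fun n => c n * (1 / Real.sinh (Real.pi * (y * n / x)))) ((x * a) ^ 2)) + K := by
  have hs := summable_norm_mul_csch hc hx hy
  have hE := fun q (hq : 0 ≤ q) => seriesEq_altKernel (κ := fun n => κ (x * n / y)) hσ hq
  have hP := hasSum_poleSum (s := fun n => c n * (1 / Real.sinh (Real.pi * (y * n / x)))) hs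
  refine ⟨2 * (y / x) * (∑' n : ℕ, (-1) ^ (n + 1) / ((n : ℝ) + 1) ^ 2) -
      2 * (x / y) * (∑' n : ℕ, c (n + 1) / ((n : ℝ) + 1) ^ 2) - 2 * Real.pi *
      (altKernelSum (fun n => κ (x * n / y)) σ 0 -
        poleSum (fun n => c n * (1 / Real.sinh (Real.pi * (y * n / x)))) 0), fun a ha hu => ?_⟩
  obtain ⟨S, T, hS, hT, h⟩ := exists_hasSum_csch_product (fun n => hc (n + 1)) hκ ha hx hy hu
    (hφ _ hu)
  have hS' := hS.unique (((hP ((x * a) ^ 2)).sub (hP 0)).congr_left_right (fun n => ?_) rfl)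
  · have hT' := SeriesEq.unique (((hE _ (sq_nonneg (y * a))).sub (hE 0 le_rfl)))
      (hT.seriesEq_of_eq (fun n => ?_) rfl)
    · rw [h, hS', ← hT']
      ring
    · have : ((n : ℝ) + 1) ≠ 0 := by positivity
      push_cast
      rw [add_zero, pow_two ((n : ℝ) + 1), div_mul_cancel_left₀ this, one_div]
      ring
  · have : ((n : ℝ) + 1) ≠ 0 := by positivity
    push_cast
    rw [sub_zero, pow_two ((n : ℝ) + 1), div_mul_cancel_left₀ this, one_div]
    ring

/-! ### Vanishing of the constant, and the products csc·csch and cot·csch. -/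

/-- The constant is found by taking a = (j + 1/2)/x with j → ∞: φ stays bounded by 1 there, csch
decays, and the rational term and both sums tend to 0. -/
theorem exists_seriesEq_csch_product (hc : ∀ n, ‖c n‖ ≤ 1)
    (hκ : ∀ v : ℝ, v ≠ 0 → HasSum (fun m : ℕ => c (m + 1) / (((m : ℝ) + 1) ^ 2 + v ^ 2))
      ((Real.pi * κ v - 1 / v) / (2 * v)))
    (hφ : ∀ u : ℝ, (∀ m : ℤ, u ≠ m) →
      HasSum (fun m : ℕ => c (m + 1) / (((m : ℝ) + 1) ^ 2 - u ^ 2))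
        ((1 / u - Real.pi * φ u) / (2 * u)))
    (hφ1 : ∀ j : ℕ, |φ ((j : ℝ) + 1 / 2)| ≤ 1) (hx : x ≠ 0) (hy : y ≠ 0)
    (hσ : Summable fun n : ℕ => ‖κ (x * ((n + 1 : ℕ) : ℝ) / y) - σ‖)
    {a : ℝ} (ha : a ≠ 0) (hu : ∀ m : ℤ, x * a ≠ m) :
    ∃ S : ℝ,
      SeriesEq (fun n : ℕ => (-1) ^ n * (n / ((n : ℝ) ^ 2 + (y * a) ^ 2)) * κ (x * n / y) -
        n / ((n : ℝ) ^ 2 - (x * a) ^ 2) *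
          (c n * (1 / Real.sinh (Real.pi * (y * n / x))))) S ∧
      Real.pi ^ 2 * φ (x * a) / Real.sinh (Real.pi * (y * a)) =
        1 / (a ^ 2 * x * y) + 2 * Real.pi * S := by
  have hs := summable_norm_mul_csch hc hx hy
  obtain ⟨K, hK⟩ := exists_csch_product_eq_add_const hc hκ hφ hx hy hσ
  suffices hK0 : K = 0 by
    refine ⟨_, (seriesEq_altKernel (κ := fun n => κ (x * n / y)) hσ (sq_nonneg (y * a))).sub
      ((hasSum_poleSum (s := fun n => c n * (1 / Real.sinh (Real.pi * (y * n / x)))) hs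
        ((x * a) ^ 2)).seriesEq_of_eq (fun n => by push_cast; rfl) rfl), ?_⟩
    rw [hK a ha hu, hK0, add_zero]
  have hj : Tendsto (fun j : ℕ => (j : ℝ) + 1 / 2) atTop atTop :=
    tendsto_atTop_add_const_right _ _ tendsto_natCast_atTop_atTop
  have hj0 : ∀ j : ℕ, (j : ℝ) + 1 / 2 ≠ 0 := fun j => by positivity
  have hxa : ∀ j : ℕ, x * (((j : ℝ) + 1 / 2) / x) = (j : ℝ) + 1 / 2 := fun j =>
    mul_div_cancel₀ _ hx
  have hyx : 0 < |y / x| := abs_pos.2 (div_ne_zero hy hx)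
  have habs : Tendsto (fun j : ℕ => |y * (((j : ℝ) + 1 / 2) / x)|) atTop atTop := by
    refine (hj.const_mul_atTop hyx).congr fun j => ?_
    have h : y * (((j : ℝ) + 1 / 2) / x) = y / x * (j + 1 / 2) := by ring
    rw [h, abs_mul, abs_of_pos (by positivity : 0 < (j : ℝ) + 1 / 2)]
  have hq : Tendsto (fun j : ℕ => (y * (((j : ℝ) + 1 / 2) / x)) ^ 2) atTop atTop := by
    refine ((tendsto_pow_atTop two_ne_zero).comp habs).congr fun j => ?_
    exact sq_abs _
  have hE := tendsto_altKernelSum (κ := fun n => κ (x * n / y)) hσ (fun j => sq_nonneg _) hq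
  have hP := tendsto_poleSum (s := fun n => c n * (1 / Real.sinh (Real.pi * (y * n / x)))) hs
  have hleft : Tendsto (fun j : ℕ => Real.pi ^ 2 * φ ((j : ℝ) + 1 / 2) /
      Real.sinh (Real.pi * (y * (((j : ℝ) + 1 / 2) / x)))) atTop (𝓝 0) := by
    have h1 : Tendsto (fun j : ℕ => |Real.pi * (y * (((j : ℝ) + 1 / 2) / x))|) atTop atTop := by
      simp_rw [abs_mul Real.pi, abs_of_pos Real.pi_pos]
      exact habs.const_mul_atTop Real.pi_pos
    have h2 := ((tendsto_one_div_sinh h1).norm).const_mul (Real.pi ^ 2)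
    rw [norm_zero, mul_zero] at h2
    rw [tendsto_zero_iff_norm_tendsto_zero]
    refine squeeze_zero (fun _ => norm_nonneg _) (fun j => ?_) h2
    rw [div_eq_mul_one_div, norm_mul, norm_mul, Real.norm_of_nonneg (sq_nonneg Real.pi), mul_assoc]
    have := mul_le_of_le_one_left
      (norm_nonneg (1 / Real.sinh (Real.pi * (y * (((j : ℝ) + 1 / 2) / x))))) (hφ1 j)
    exact mul_le_mul_of_nonneg_left this (sq_nonneg _)
  have hmid : Tendsto (fun j : ℕ => 1 / ((((j : ℝ) + 1 / 2) / x) ^ 2 * x * y)) atTop (𝓝 0) := by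
    have h1 : Tendsto (fun j : ℕ => x / y / ((j : ℝ) + 1 / 2) ^ 2) atTop (𝓝 0) :=
      tendsto_const_nhds.div_atTop ((tendsto_pow_atTop two_ne_zero).comp hj)
    refine h1.congr fun j => ?_
    have := hj0 j
    field_simp
  have hlim := (hleft.sub hmid).sub ((hE.sub hP).const_mul (2 * Real.pi))
  simp only [sub_zero, mul_zero] at hlim
  refine tendsto_nhds_unique tendsto_const_nhds (hlim.congr fun j => ?_)
  have := hK (((j : ℝ) + 1 / 2) / x) (div_ne_zero (hj0 j) hx)
    (fun m => by rw [hxa]; exact natCast_add_one_half_ne_intCast j m)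
  rw [hxa] at this
  rw [this]
  ring

end CschProduct

variable {a x y : ℝ}

theorem exists_seriesEq_csc_mul_csch (ha : a ≠ 0) (hx : x ≠ 0) (hy : y ≠ 0)
    (hu : ∀ m : ℤ, x * a ≠ (m : ℝ)) :
    ∃ S : ℝ,
      SeriesEq (fun n : ℕ =>
        (n : ℝ) * (-1) ^ n /
            (((n : ℝ) ^ 2 + a ^ 2 * y ^ 2) * Real.sinh (Real.pi * n * x / y))
          - (n : ℝ) * (-1) ^ n /
            (((n : ℝ) ^ 2 - a ^ 2 * x ^ 2) * Real.sinh (Real.pi * n * y / x))) S ∧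
      Real.pi ^ 2 / (Real.sin (Real.pi * x * a) * Real.sinh (Real.pi * y * a))
        = 1 / (a ^ 2 * x * y) + 2 * Real.pi * S := by
  have hσ : Summable fun n : ℕ =>
      ‖1 / Real.sinh (Real.pi * (x * ((n + 1 : ℕ) : ℝ) / y)) - 0‖ := by
    simpa using summable_norm_mul_csch (c := fun _ => 1) (by simp) hy hx
  have hφ1 : ∀ j : ℕ, |1 / Real.sin (Real.pi * ((j : ℝ) + 1 / 2))| ≤ 1 := fun j => by
    have : Real.pi * ((j : ℝ) + 1 / 2) = Real.pi / 2 + j * Real.pi := by ring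
    rw [this, Real.sin_add_nat_mul_pi, Real.sin_pi_div_two]
    simp
  obtain ⟨S, hS, h⟩ := exists_seriesEq_csch_product (c := fun n => (-1) ^ n)
    (κ := fun v => 1 / Real.sinh (Real.pi * v)) (φ := fun u => 1 / Real.sin (Real.pi * u))
    (fun n => by simp) (fun v hv => Real.hasSum_csch_pi hv)
    (fun u hu => by simpa [div_eq_mul_inv] using Real.hasSum_csc_pi hu) hφ1 hx hy hσ ha hu
  · refine ⟨S, hS.congr fun n => ?_, ?_⟩
    · rw [show (y * a) ^ 2 = a ^ 2 * y ^ 2 by ring, show (x * a) ^ 2 = a ^ 2 * x ^ 2 by ring,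
        show ∀ z w : ℝ, Real.pi * ((n + 1 : ℕ) : ℝ) * z / w
          = Real.pi * (z * ((n + 1 : ℕ) : ℝ) / w) by intro z w; ring, ← div_div, ← div_div]
      ring_nf
    · rw [← h, mul_assoc Real.pi x, mul_assoc Real.pi y]
      ring

theorem exists_seriesEq_cot_mul_csch (ha : a ≠ 0) (hx : x ≠ 0) (hy : y ≠ 0)
    (hu : ∀ m : ℤ, x * a ≠ (m : ℝ)) :
    ∃ S : ℝ,
      SeriesEq (fun n : ℕ =>
        (n : ℝ) * coth (Real.pi * n * x / y) / ((n : ℝ) ^ 2 + a ^ 2 * y ^ 2) * (-1) ^ n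
          - (n : ℝ) /
            (((n : ℝ) ^ 2 - a ^ 2 * x ^ 2) * Real.sinh (Real.pi * n * y / x))) S ∧
      Real.pi ^ 2 * Real.cot (Real.pi * x * a) / Real.sinh (Real.pi * y * a)
        = 1 / (a ^ 2 * x * y) + 2 * Real.pi * S := by
  -- Here σ = ±1 is the limit of the kernel; the sign depends on x/y because x and y need not be
  -- positive.
  have hσ : Summable fun n : ℕ => ‖coth (Real.pi * (x * ((n + 1 : ℕ) : ℝ) / y)) -
      (SignType.sign (Real.pi * x / y) : ℝ)‖ := by
    refine (summable_norm_coth_sub (div_ne_zero (mul_ne_zero Real.pi_ne_zero hx) hy)).congr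
      fun n => ?_
    rw [coth, show Real.pi * (x * ((n + 1 : ℕ) : ℝ) / y) = Real.pi * x / y * ((n : ℝ) + 1) by
      push_cast; ring]
  have hφ1 : ∀ j : ℕ, |Real.cot (Real.pi * ((j : ℝ) + 1 / 2))| ≤ 1 := fun j => by
    have : Real.pi * ((j : ℝ) + 1 / 2) = Real.pi / 2 + j * Real.pi := by ring
    rw [this, Real.cot_eq_cos_div_sin, Real.cos_add_nat_mul_pi, Real.cos_pi_div_two]
    simp
  obtain ⟨S, hS, h⟩ := exists_seriesEq_csch_product (c := fun _ => 1)
    (κ := fun v => coth (Real.pi * v)) (φ := fun u => Real.cot (Real.pi * u))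
    (fun n => by simp) (fun v hv => Real.hasSum_coth_pi hv)
    (fun u hu => Real.hasSum_cot_pi hu) hφ1 hx hy hσ ha hu
  · refine ⟨S, hS.congr fun n => ?_, ?_⟩
    · rw [show (y * a) ^ 2 = a ^ 2 * y ^ 2 by ring, show (x * a) ^ 2 = a ^ 2 * x ^ 2 by ring,
        show ∀ z w : ℝ, Real.pi * ((n + 1 : ℕ) : ℝ) * z / w
          = Real.pi * (z * ((n + 1 : ℕ) : ℝ) / w) by intro z w; ring, ← div_div]
      ring_nf
    · rw [← h, mul_assoc Real.pi x, mul_assoc Real.pi y]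

/-! ### Change of variables to α, β, w and the final assembly. -/

theorem SeriesEq.div_const {f g : ℕ → ℝ} {s : ℝ} (hf : SeriesEq f s) {r : ℝ} (hr : r ≠ 0)
    (h : ∀ n : ℕ, f (n + 1) = r * g (n + 1)) : SeriesEq g (s / r) := by
  have := (hf.const_mul r⁻¹).congr (g := g) fun n => by rw [h, inv_mul_cancel_left₀ hr]
  rwa [div_eq_inv_mul]

section Reciprocal

variable {α β w : ℝ}

theorem exists_sqrt_parametrization (hα : 0 < α) (hβ : 0 < β) (hw : 0 < w)
    (h : α * β = Real.pi ^ 2) :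
    ∃ a x y : ℝ, 0 < a ∧ 0 < x ∧ 0 < y ∧ α = x ^ 2 ∧ β = y ^ 2 ∧ w = x ^ 2 * y ^ 2 * a ^ 2 ∧
      Real.pi = x * y ∧ Real.sqrt (w * α) = Real.pi * x * a ∧
      Real.sqrt (w * β) = Real.pi * y * a := by
  have hpi := Real.pi_pos
  have hx := Real.sqrt_pos.2 hα
  have hy := Real.sqrt_pos.2 hβ
  have hs := Real.sqrt_pos.2 hw
  have hxy : Real.sqrt α * Real.sqrt β = Real.pi := by
    rw [← Real.sqrt_mul hα.le, h, Real.sqrt_sq hpi.le]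
  refine ⟨Real.sqrt w / Real.pi, Real.sqrt α, Real.sqrt β, by positivity, hx, hy,
    (Real.sq_sqrt hα.le).symm, (Real.sq_sqrt hβ.le).symm, ?_, hxy.symm, ?_, ?_⟩
  · rw [← mul_pow, hxy, div_pow, Real.sq_sqrt hw.le]
    field_simp
  · rw [Real.sqrt_mul hw.le]
    field_simp
  · rw [Real.sqrt_mul hw.le]
    field_simp

end Reciprocal

theorem theorem3p1 :
    -- the expansions in the variables `a`, `x`, `y`
    (∀ a x y : ℝ, a ≠ 0 → x ≠ 0 → y ≠ 0 →
      -- `x * a` is not an integer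
      ((∀ m : ℤ, x * a ≠ (m : ℝ)) →
        (∃ S : ℝ,
          SeriesEq (fun n : ℕ =>
            (n : ℝ) * (-1) ^ n /
                (((n : ℝ) ^ 2 + a ^ 2 * y ^ 2) * Real.sinh (Real.pi * n * x / y))
              - (n : ℝ) * (-1) ^ n /
                (((n : ℝ) ^ 2 - a ^ 2 * x ^ 2) * Real.sinh (Real.pi * n * y / x))) S ∧
          Real.pi ^ 2 / (Real.sin (Real.pi * x * a) * Real.sinh (Real.pi * y * a))
            = 1 / (a ^ 2 * x * y) + 2 * Real.pi * S) ∧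
        (∃ S : ℝ,
          SeriesEq (fun n : ℕ =>
            (n : ℝ) * coth (Real.pi * n * x / y) / ((n : ℝ) ^ 2 + a ^ 2 * y ^ 2) * (-1) ^ n
              - (n : ℝ) /
                (((n : ℝ) ^ 2 - a ^ 2 * x ^ 2) * Real.sinh (Real.pi * n * y / x))) S ∧
          Real.pi ^ 2 * Real.cot (Real.pi * x * a) / Real.sinh (Real.pi * y * a)
            = 1 / (a ^ 2 * x * y) + 2 * Real.pi * S)) ∧
      -- `x * a` is not half of an odd integer
      ((∀ m : ℤ, x * a ≠ (2 * (m : ℝ) - 1) / 2) →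
        SeriesEq (fun n : ℕ =>
            Real.pi * x ^ 2 * Real.tanh ((2 * (n : ℝ) - 1) / (2 * x) * Real.pi * y) /
                ((2 * (n : ℝ) - 1) * ((2 * (n : ℝ) - 1) ^ 2 - (2 * x * a) ^ 2))
              + Real.pi * y ^ 2 * Real.tanh ((2 * (n : ℝ) - 1) / (2 * y) * Real.pi * x) /
                ((2 * (n : ℝ) - 1) * ((2 * (n : ℝ) - 1) ^ 2 + (2 * y * a) ^ 2)))
          (Real.pi ^ 2 * Real.tan (Real.pi * x * a) * Real.tanh (Real.pi * y * a) /
            (16 * a ^ 2)) ∧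
        (∃ S T : ℝ,
          SeriesEq (fun n : ℕ =>
            Real.pi * y ^ 2 * (-1) ^ n /
              ((2 * (n : ℝ) - 1) * ((2 * (n : ℝ) - 1) ^ 2 + (2 * y * a) ^ 2) *
                Real.cosh ((2 * (n : ℝ) - 1) / (2 * y) * Real.pi * x))) S ∧
          SeriesEq (fun n : ℕ =>
            Real.pi * x ^ 2 * (-1) ^ n /
              ((2 * (n : ℝ) - 1) * ((2 * (n : ℝ) - 1) ^ 2 - (2 * x * a) ^ 2) *
                Real.cosh ((2 * (n : ℝ) - 1) / (2 * x) * Real.pi * y))) T ∧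
          Real.pi ^ 2 /
              (16 * a ^ 2 * Real.cos (Real.pi * x * a) * Real.cosh (Real.pi * y * a))
            = Real.pi ^ 2 / (16 * a ^ 2) + S - T))) ∧
    -- the expansions in the variables `w`, `α`, `β`, where `α * β = π ^ 2`
    (∀ α β w : ℝ, 0 < α → 0 < β → 0 < w → α * β = Real.pi ^ 2 →
      ((∀ n : ℕ, 1 ≤ n → w ≠ β * (n : ℝ) ^ 2) →
        (∃ S : ℝ,
          SeriesEq (fun n : ℕ =>
            β * (n : ℝ) * (-1) ^ n / ((w - β * (n : ℝ) ^ 2) * Real.sinh (β * n))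
              + α * (n : ℝ) * (-1) ^ n / ((w + α * (n : ℝ) ^ 2) * Real.sinh (α * n))) S ∧
          Real.pi / (2 * Real.sin (Real.sqrt (w * α)) * Real.sinh (Real.sqrt (w * β)))
            = 1 / (2 * w) + S) ∧
        (∃ S : ℝ,
          SeriesEq (fun n : ℕ =>
            β * (n : ℝ) / ((w - β * (n : ℝ) ^ 2) * Real.sinh (β * n))
              + α * (n : ℝ) * coth (α * n) / (w + α * (n : ℝ) ^ 2) * (-1) ^ n) S ∧
          Real.pi * Real.cot (Real.sqrt (w * α)) / (2 * Real.sinh (Real.sqrt (w * β)))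
            = 1 / (2 * w) + S)) ∧
      ((∀ n : ℕ, 1 ≤ n → 4 * w ≠ β * (2 * (n : ℝ) - 1) ^ 2) →
        SeriesEq (fun n : ℕ =>
            Real.tanh ((2 * (n : ℝ) - 1) / 2 * β) /
                ((2 * (n : ℝ) - 1) * (β * (2 * (n : ℝ) - 1) ^ 2 - 4 * w))
              + Real.tanh ((2 * (n : ℝ) - 1) / 2 * α) /
                ((2 * (n : ℝ) - 1) * (α * (2 * (n : ℝ) - 1) ^ 2 + 4 * w)))
          (Real.pi * Real.tan (Real.sqrt (w * α)) * Real.tanh (Real.sqrt (w * β)) /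
            (16 * w)) ∧
        (∃ S T : ℝ,
          SeriesEq (fun n : ℕ =>
            (-1) ^ n /
              ((2 * (n : ℝ) - 1) * (4 * w - β * (2 * (n : ℝ) - 1) ^ 2) *
                Real.cosh ((2 * (n : ℝ) - 1) / 2 * β))) S ∧
          SeriesEq (fun n : ℕ =>
            (-1) ^ n /
              ((2 * (n : ℝ) - 1) * (4 * w + α * (2 * (n : ℝ) - 1) ^ 2) *
                Real.cosh ((2 * (n : ℝ) - 1) / 2 * α))) T ∧
          Real.pi / (16 * w * Real.cos (Real.sqrt (w * α)) * Real.cosh (Real.sqrt (w * β)))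
            = Real.pi / (16 * w) + S + T))) := by
  refine ⟨fun a x y ha hx hy => ⟨fun hu => ⟨exists_seriesEq_csc_mul_csch ha hx hy hu,
    exists_seriesEq_cot_mul_csch ha hx hy hu⟩, fun hu => ⟨seriesEq_tan_mul_tanh ha hx hy hu,
    exists_seriesEq_sec_mul_sech ha hx hy hu⟩⟩, fun α β w hα hβ hw h => ?_⟩
  obtain ⟨a, x, y, ha, hx, hy, rfl, rfl, hwa, hpi, h1, h2⟩ :=
    exists_sqrt_parametrization hα hβ hw h
  rw [h1, h2]
  have hpi0 := Real.pi_pos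
  have ha0 := ha.ne'
  have hx0 := hx.ne'
  have hy0 := hy.ne'
  -- With π = xy the hyperbolic arguments become multiples of y² = β and x² = α.
  have hdx : ∀ z : ℝ, Real.pi * z * y / x = y ^ 2 * z := fun z => by rw [hpi]; field_simp
  have hdy : ∀ z : ℝ, Real.pi * z * x / y = x ^ 2 * z := fun z => by rw [hpi]; field_simp
  have hox : ∀ z : ℝ, z / (2 * x) * Real.pi * y = z / 2 * y ^ 2 := fun z => by
    rw [hpi]; field_simp
  have hoy : ∀ z : ℝ, z / (2 * y) * Real.pi * x = z / 2 * x ^ 2 := fun z => by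
    rw [hpi]; field_simp
  refine ⟨fun hne => ?_, fun hne => ?_⟩
  -- Since xa > 0, only positive integers can be hit, which are exactly those excluded by the
  -- hypothesis on w.
  · have hu : ∀ m : ℤ, x * a ≠ (m : ℝ) := by
      intro m hm
      have hm0 : 0 < m := by
        have : (0 : ℝ) < m := hm ▸ mul_pos hx ha
        exact_mod_cast this
      refine hne m.toNat (by omega) ?_
      have : ((m.toNat : ℕ) : ℝ) = m := by exact_mod_cast Int.toNat_of_nonneg hm0.le
      rw [this, ← hm, hwa]
      ring
    have hA : ∀ n : ℕ, w - y ^ 2 * (n : ℝ) ^ 2 = -(y ^ 2) * ((n : ℝ) ^ 2 - a ^ 2 * x ^ 2) :=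
      fun n => by rw [hwa]; ring
    have hB : ∀ n : ℕ, w + x ^ 2 * (n : ℝ) ^ 2 = x ^ 2 * ((n : ℝ) ^ 2 + a ^ 2 * y ^ 2) :=
      fun n => by rw [hwa]; ring
    constructor
    · obtain ⟨S, hS, hval⟩ := exists_seriesEq_csc_mul_csch ha0 hx0 hy0 hu
      refine ⟨S, hS.congr fun n => ?_, ?_⟩
      · rw [hA, hB, hdx, hdy]
        generalize ((n + 1 : ℕ) : ℝ) ^ 2 - a ^ 2 * x ^ 2 = U
        generalize ((n + 1 : ℕ) : ℝ) ^ 2 + a ^ 2 * y ^ 2 = V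
        generalize Real.sinh _ = s
        generalize Real.sinh _ = t
        rw [neg_mul, neg_mul, div_neg, mul_assoc (y ^ 2), mul_assoc (y ^ 2), mul_assoc (x ^ 2),
          mul_assoc (x ^ 2), mul_div_mul_left _ _ (pow_ne_zero 2 hx0),
          mul_div_mul_left _ _ (pow_ne_zero 2 hy0)]
        ring
      · have hS2 : S = (Real.pi ^ 2 / (Real.sin (Real.pi * x * a) * Real.sinh (Real.pi * y * a)) -
            1 / (a ^ 2 * x * y)) / (2 * Real.pi) := by
          rw [hval]; field_simp; ring
        rw [hS2, hwa, mul_assoc 2]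
        generalize Real.sin (Real.pi * x * a) * Real.sinh (Real.pi * y * a) = D
        rw [hpi]
        field_simp
        ring
    · obtain ⟨S, hS, hval⟩ := exists_seriesEq_cot_mul_csch ha0 hx0 hy0 hu
      refine ⟨S, hS.congr fun n => ?_, ?_⟩
      · rw [hA, hB, hdx, hdy]
        generalize ((n + 1 : ℕ) : ℝ) ^ 2 - a ^ 2 * x ^ 2 = U
        generalize ((n + 1 : ℕ) : ℝ) ^ 2 + a ^ 2 * y ^ 2 = V
        generalize Real.sinh _ = s
        generalize coth _ = t
        rw [neg_mul, neg_mul, div_neg, mul_assoc (y ^ 2), mul_assoc (x ^ 2),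
          mul_div_mul_left _ _ (pow_ne_zero 2 hx0), mul_div_mul_left _ _ (pow_ne_zero 2 hy0)]
        ring
      · have hS2 : S = (Real.pi ^ 2 * Real.cot (Real.pi * x * a) / Real.sinh (Real.pi * y * a) -
            1 / (a ^ 2 * x * y)) / (2 * Real.pi) := by
          rw [hval]; field_simp; ring
        rw [hS2, hwa]
        generalize Real.cot (Real.pi * x * a) = C
        generalize Real.sinh (Real.pi * y * a) = D
        rw [hpi]
        field_simp
        ring
  · have hu : ∀ m : ℤ, x * a ≠ (2 * (m : ℝ) - 1) / 2 := by
      intro m hm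
      have hm0 : 0 < m := by
        have : (0 : ℝ) < 2 * m - 1 := by linarith [mul_pos hx ha]
        have : 0 < 2 * m - 1 := by exact_mod_cast this
        omega
      refine hne m.toNat (by omega) ?_
      have : ((m.toNat : ℕ) : ℝ) = m := by exact_mod_cast Int.toNat_of_nonneg hm0.le
      rw [this, show 2 * (m : ℝ) - 1 = 2 * (x * a) by linarith, hwa]
      ring
    have hA : ∀ p : ℝ, y ^ 2 * p ^ 2 - 4 * w = y ^ 2 * (p ^ 2 - (2 * x * a) ^ 2) :=
      fun n => by rw [hwa]; ring
    have hA' : ∀ p : ℝ, 4 * w - y ^ 2 * p ^ 2 = -(y ^ 2) * (p ^ 2 - (2 * x * a) ^ 2) :=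
      fun n => by rw [hwa]; ring
    have hB : ∀ p : ℝ, x ^ 2 * p ^ 2 + 4 * w = x ^ 2 * (p ^ 2 + (2 * y * a) ^ 2) :=
      fun n => by rw [hwa]; ring
    have hB' : ∀ p : ℝ, 4 * w + x ^ 2 * p ^ 2 = x ^ 2 * (p ^ 2 + (2 * y * a) ^ 2) :=
      fun n => by rw [hwa]; ring
    constructor
    · have hS := seriesEq_tan_mul_tanh ha0 hx0 hy0 hu
      -- The two normalisations differ by πx²y² = π³.
      have := hS.div_const (pow_ne_zero 3 hpi0.ne') (g := fun n : ℕ =>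
            Real.tanh ((2 * (n : ℝ) - 1) / 2 * y ^ 2) /
                ((2 * (n : ℝ) - 1) * (y ^ 2 * (2 * (n : ℝ) - 1) ^ 2 - 4 * w))
              + Real.tanh ((2 * (n : ℝ) - 1) / 2 * x ^ 2) /
                ((2 * (n : ℝ) - 1) * (x ^ 2 * (2 * (n : ℝ) - 1) ^ 2 + 4 * w))) fun n => ?_
      · convert this using 1
        generalize Real.tan _ = C
        generalize Real.tanh _ = D
        rw [hwa, hpi]
        field_simp
      · rw [hA, hB, hox, hoy]
        generalize (2 * ((n + 1 : ℕ) : ℝ) - 1) ^ 2 - (2 * x * a) ^ 2 = U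
        generalize (2 * ((n + 1 : ℕ) : ℝ) - 1) ^ 2 + (2 * y * a) ^ 2 = V
        generalize Real.tanh _ = s
        generalize Real.tanh _ = t
        generalize 2 * ((n + 1 : ℕ) : ℝ) - 1 = p
        rw [hpi]
        field_simp
    · obtain ⟨S, T, hS, hT, hval⟩ := exists_seriesEq_sec_mul_sech ha0 hx0 hy0 hu
      -- The β-series comes from the subtracted series T; its factor 4w − β(2n − 1)² has the
      -- opposite sign to (2n − 1)² − (2xa)², hence −π³.
      refine ⟨T / -Real.pi ^ 3, S / Real.pi ^ 3,
        hT.div_const (neg_ne_zero.2 (pow_ne_zero 3 hpi0.ne')) fun n => ?_,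
        hS.div_const (pow_ne_zero 3 hpi0.ne') fun n => ?_, ?_⟩
      · rw [hA', hox]
        generalize (2 * ((n + 1 : ℕ) : ℝ) - 1) ^ 2 - (2 * x * a) ^ 2 = U
        generalize Real.cosh _ = s
        generalize 2 * ((n + 1 : ℕ) : ℝ) - 1 = p
        rw [hpi]
        field_simp
      · rw [hB', hoy]
        generalize (2 * ((n + 1 : ℕ) : ℝ) - 1) ^ 2 + (2 * y * a) ^ 2 = V
        generalize Real.cosh _ = s
        generalize 2 * ((n + 1 : ℕ) : ℝ) - 1 = p
        rw [hpi]
        field_simp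
      · have hS2 : S = Real.pi ^ 2 / (16 * a ^ 2 * Real.cos (Real.pi * x * a) *
            Real.cosh (Real.pi * y * a)) - Real.pi ^ 2 / (16 * a ^ 2) + T := by
          rw [hval]; ring
        rw [hS2, hwa]
        generalize Real.cos (Real.pi * x * a) = C
        generalize Real.cosh (Real.pi * y * a) = D
        rw [hpi]
        field_simp
        ring
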